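/- Let $A\in\mathbb R^{n\times n}$, $B\in\mathbb R^{n\times m}$, $K\in\mathbb R^{m\times n}$ with spectral radius $\rho(A)>1$ and $A+BK=0$ (one-step controllable plant). Let $Q,R\in\mathbb R^{n\times n}$ be symmetric positive definite and $p_s,p_c\in(0,1)$. The plant is $x_{k+1}=Ax_k+Bu_k+w_k$, $k\ge 0$, with i.i.d. disturbances $w_k\sim\mathcal N(0,R)$. In each time slot $k$ a half-duplex controller takes an action $a_k\in\{1,2\}$: if $a_k=1$, the sensor sends the exact value of $x_k$ to the controller, and this packet is lost with probability $p_s$; if $a_k=2$, the controller sends a command to the actuator, and this packet is lost with probability $p_c$. Put $\delta_k=1$ if $a_k=1$ and the packet is received, $\gamma_k=1$ if $a_k=2$ and the packet is received, and $\delta_k=0$, $\gamma_k=0$ otherwise. The input is $u_k=K\hat x_k$ if $\gamma_k=1$ and $u_k=0$ otherwise; the controller's estimate is $\hat x_{k+1}=Ax_k+Bu_k$ if $\delta_k=1$ and $\hat x_{k+1}=A\hat x_k+Bu_k$ otherwise. Let $F(\tau)=\sum_{i=1}^{\tau}A^{i-1}R(A^\top)^{i-1}$ and $\mathbb S=\{(\tau,\phi):\tau\ge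 1,\ \phi\ge 2,\ \phi\ge\tau,\ \phi\ne\tau+1\}\subset\mathbb N^2$. The indicators $(\tau_k,\phi_k)\in\mathbb S$ evolve by $\tau_{k+1}=1$ if $\delta_k=1$ and $\tau_{k+1}=\tau_k+1$ otherwise; $\phi_{k+1}=\tau_k+1$ if $\gamma_k=1$ and $\phi_{k+1}=\phi_k+1$ otherwise. For an initial value $(\tau_0,\phi_0)\in\mathbb S$, the loop starts from random vectors $x_0,\hat x_0$ with $\mathbb E[x_0x_0^\top]=F(\phi_0)$ and $\mathbb E[(x_0-\hat x_0)(x_0-\hat x_0)^\top]=F(\tau_0)$. The initial pair $(x_0,\hat x_0)$, the disturbances, the packet losses of the two channels in the different slots, and a private randomization of the scheduler are mutually independent. An admissible scheduling policy chooses $a_k$ as a measurable function of the private randomization and of $(a_j,\delta_j,\gamma_j)_{j<k}$. A stationary deterministic policy is a map $\pi:\mathbb S\to\{1,2\}$, used as $a_k=\pi(\tau_k,\phi_k)$. Write $J_N=\frac1N\sum_{k=0}^{N-1}\mathbb E[x_k^\top Qx_k]$. The policy $\pi$ is optimal if there is $J\in[0,\infty]$ such that, from every initial value in $\mathbb S$,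 $J_N\to J$ under $\pi$ while $\liminf_{N\to\infty}J_N\ge J$ under every admissible policy. A policy stabilizes the plant if its average cost is bounded, i.e. $\limsup_{N\to\infty}J_N<\infty$. Then there exists an optimal stationary deterministic scheduling policy that stabilizes the plant from every initial value in $\mathbb S$ if and only if $$\max\{p_s,p_c\}<\frac{1}{\rho^2(A)}.$$ -/

import Mathlib

open MeasureTheory ProbabilityTheory Filter Topology
open scoped ENNReal Matrix

namespace HalfDuplex

/-- The half-duplex controller either listens to the sensor (uplink) or transmits a command to the
actuator (downlink) in each time slot. -/
inductive Action
  | sensor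
  | controller
  deriving DecidableEq

instance : MeasurableSpace Action := ⊤

/-- The spectral radius of a real square matrix: the largest modulus of a complex eigenvalue. -/
noncomputable def specRadius {n : ℕ} (A : Matrix (Fin n) (Fin n) ℝ) : ℝ :=
  (spectralRadius ℂ (A.map (algebraMap ℝ ℂ))).toReal

/-- `F τ = ∑_{i=1}^{τ} A^{i-1} R (Aᵀ)^{i-1}`. -/
def covF {n : ℕ} (A R : Matrix (Fin n) (Fin n) ℝ) (τ : ℕ) : Matrix (Fin n) (Fin n) ℝ :=
  ∑ i ∈ Finset.range τ, A ^ i * R * Aᵀ ^ i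

/-- The state space: pairs `(τ, φ)` of the estimation-quality indicator `τ ∈ {1, 2, …}` and the
state-quality indicator `φ ∈ {2, 3, …}` with `φ ≥ τ` and `φ ≠ τ + 1`. -/
def stateSpace : Set (ℕ × ℕ) :=
  {s | 1 ≤ s.1 ∧ 2 ≤ s.2 ∧ s.1 ≤ s.2 ∧ s.2 ≠ s.1 + 1}

/-- The update of `(τ, φ)` in a slot with action `a`; `up` and `dn` tell whether a packet sent in
this slot over the uplink, respectively the downlink, gets through. -/
def step (a : Action) (up dn : Bool) (s : stateSpace) : stateSpace :=
  ⟨(if a = .sensor ∧ up = true then 1 else s.1.1 + 1,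
    if a = .controller ∧ dn = true then s.1.1 + 1 else s.1.2 + 1), by
    obtain ⟨⟨τ, φ⟩, h1, h2, h3, h4⟩ := s
    simp only at h1 h2 h3 h4
    cases a <;> cases up <;> cases dn <;> simp [stateSpace] <;> omega⟩

/-- A stationary deterministic scheduling policy. -/
abbrev StationaryPolicy := stateSpace → Action

/-- The mutually independent sources of randomness of the control loop. -/
inductive Source
  | initial
  | privateRand
  | noise (k : ℕ)
  | uplink (k : ℕ)
  | downlink (k : ℕ)

/-- The primitive random objects on a probability space `(Ω, P)`: white Gaussian plant disturbance
of covariance `R`, memoryless channels with packet-error probabilities `ps` and `pc`, private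
randomness `ζ` that a scheduler may use, and, for every initial value `s = (τ, φ)` of the
indicators, an initial plant state `x₀ s` and initial estimate `xhat₀ s` for which the plant-state
covariance is `F φ` and the estimation-error covariance is `F τ`. -/
structure Environment {Ω : Type*} [MeasurableSpace Ω] (P : Measure Ω) {n : ℕ}
    (A R : Matrix (Fin n) (Fin n) ℝ) (ps pc : ℝ) where
  /-- plant disturbance -/
  w : ℕ → Ω → (Fin n → ℝ)
  /-- `up k ω`: a sensor packet sent in slot `k` is received -/
  up : ℕ → Ω → Bool
  /-- `dn k ω`: a control packet sent in slot `k` is received -/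
  dn : ℕ → Ω → Bool
  /-- private randomness of the scheduler, of arbitrary (possibly degenerate) law -/
  ζ : Ω → ℝ
  /-- initial plant state -/
  x₀ : stateSpace → Ω → (Fin n → ℝ)
  /-- initial estimate -/
  xhat₀ : stateSpace → Ω → (Fin n → ℝ)
  measurable_w : ∀ k, Measurable (w k)
  measurable_up : ∀ k, Measurable (up k)
  measurable_dn : ∀ k, Measurable (dn k)
  measurable_ζ : Measurable ζ
  measurable_x₀ : ∀ s, Measurable (x₀ s)
  measurable_xhat₀ : ∀ s, Measurable (xhat₀ s)
  law_w : ∀ k, P.map (fun ω => WithLp.toLp 2 (w k ω)) = multivariateGaussian 0 R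
  prob_up : ∀ k, P {ω | up k ω = false} = ENNReal.ofReal ps
  prob_dn : ∀ k, P {ω | dn k ω = false} = ENNReal.ofReal pc
  memLp_x₀ : ∀ s i, MemLp (fun ω => x₀ s ω i) 2 P
  memLp_xhat₀ : ∀ s i, MemLp (fun ω => xhat₀ s ω i) 2 P
  cov_x₀ : ∀ s i j, ∫ ω, x₀ s ω i * x₀ s ω j ∂P = covF A R s.1.2 i j
  cov_err₀ : ∀ s i j,
    ∫ ω, (x₀ s ω i - xhat₀ s ω i) * (x₀ s ω j - xhat₀ s ω j) ∂P = covF A R s.1.1 i j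
  indep : ∀ s, iIndep (fun src : Source => match src with
    | .initial => MeasurableSpace.comap (fun ω => (x₀ s ω, xhat₀ s ω)) inferInstance
    | .privateRand => MeasurableSpace.comap ζ inferInstance
    | .noise k => MeasurableSpace.comap (w k) inferInstance
    | .uplink k => MeasurableSpace.comap (up k) inferInstance
    | .downlink k => MeasurableSpace.comap (dn k) inferInstance) P

namespace Environment

variable {Ω : Type*} [MeasurableSpace Ω] {P : Measure Ω} {n m : ℕ}
  {A R : Matrix (Fin n) (Fin n) ℝ} {ps pc : ℝ}

/-- `δ_k = 1`: the sensor's transmission is scheduled in slot `k` and succeeds. -/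
def delta (env : Environment P A R ps pc) (a : ℕ → Ω → Action) (k : ℕ) (ω : Ω) : Bool :=
  decide (a k ω = .sensor) && env.up k ω

/-- `γ_k = 1`: the controller's transmission is scheduled in slot `k` and succeeds. -/
def gamma (env : Environment P A R ps pc) (a : ℕ → Ω → Action) (k : ℕ) (ω : Ω) : Bool :=
  decide (a k ω = .controller) && env.dn k ω

/-- The pair `(x_k, x̂_k)` of plant state and estimate under the scheduling sequence `a`. The input
is `u_k = K x̂_k` if a control packet is received in slot `k` and `u_k = 0` otherwise; then
`x_{k+1} = A x_k + B u_k + w_k`, and `x̂_{k+1}` is `A x_k + B u_k` if a measurement is received in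
slot `k` and `A x̂_k + B u_k` otherwise. -/
def loop (env : Environment P A R ps pc) (B : Matrix (Fin n) (Fin m) ℝ)
    (K : Matrix (Fin m) (Fin n) ℝ) (a : ℕ → Ω → Action) (s : stateSpace) :
    ℕ → Ω → (Fin n → ℝ) × (Fin n → ℝ)
  | 0, ω => (env.x₀ s ω, env.xhat₀ s ω)
  | k + 1, ω =>
    let x := (env.loop B K a s k ω).1
    let xhat := (env.loop B K a s k ω).2
    let u : Fin m → ℝ := if env.gamma a k ω = true then K *ᵥ xhat else 0
    (A *ᵥ x + B *ᵥ u + env.w k ω,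
      if env.delta a k ω = true then A *ᵥ x + B *ᵥ u else A *ᵥ xhat + B *ᵥ u)

/-- The expected cost up to time `N`, divided by `N`:
`(1/N) ∑_{k<N} E[x_kᵀ Q x_k]`, as an element of `[0, ∞]`. -/
noncomputable def avgCost (env : Environment P A R ps pc) (B : Matrix (Fin n) (Fin m) ℝ)
    (K : Matrix (Fin m) (Fin n) ℝ) (Q : Matrix (Fin n) (Fin n) ℝ)
    (a : ℕ → Ω → Action) (s : stateSpace) (N : ℕ) : ℝ≥0∞ :=
  (∑ k ∈ Finset.range N, ∫⁻ ω, ENNReal.ofReal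
    ((env.loop B K a s k ω).1 ⬝ᵥ Q *ᵥ (env.loop B K a s k ω).1) ∂P) / N

/-- What a scheduler may know when it chooses `a k`: private randomness and the actions and
transmission outcomes of the slots before `k`. -/
@[reducible]
def info (env : Environment P A R ps pc) (a : ℕ → Ω → Action) (k : ℕ) : MeasurableSpace Ω :=
  MeasurableSpace.comap env.ζ inferInstance ⊔ ⨆ j : Fin k, MeasurableSpace.comap
    (fun ω => (a j ω, env.delta a j ω, env.gamma a j ω)) inferInstance

/-- A (possibly history-dependent and randomized) causal scheduling sequence. -/
def Admissible (env : Environment P A R ps pc) (a : ℕ → Ω → Action) : Prop :=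
  ∀ k, Measurable[env.info a k] (a k)

/-- The indicators `(τ_k, φ_k)` under a stationary policy, started at `s`. -/
def policyState (env : Environment P A R ps pc) (π : StationaryPolicy) (s : stateSpace) :
    ℕ → Ω → stateSpace
  | 0, _ => s
  | k + 1, ω => step (π (env.policyState π s k ω)) (env.up k ω) (env.dn k ω)
      (env.policyState π s k ω)

/-- The scheduling sequence `a_k = π (τ_k, φ_k)` of a stationary policy, started at `s`. -/
def policyActions (env : Environment P A R ps pc) (π : StationaryPolicy) (s : stateSpace)
    (k : ℕ) (ω : Ω) : Action :=
  π (env.policyState π s k ω)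

/-- The scheduling sequence `a` stabilizes the plant from `s`: the average cost is bounded. -/
def Stabilizes (env : Environment P A R ps pc) (B : Matrix (Fin n) (Fin m) ℝ)
    (K : Matrix (Fin m) (Fin n) ℝ) (Q : Matrix (Fin n) (Fin n) ℝ)
    (a : ℕ → Ω → Action) (s : stateSpace) : Prop :=
  limsup (env.avgCost B K Q a s) atTop < ⊤

/-- The stationary policy `π` is average-cost optimal: its average costs converge, from every
initial state, to one and the same value `J`, and no admissible scheduling sequence has a
smaller average cost (not even along a subsequence of times) from any initial state. -/
def IsOptimal (env : Environment P A R ps pc) (B : Matrix (Fin n) (Fin m) ℝ)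
    (K : Matrix (Fin m) (Fin n) ℝ) (Q : Matrix (Fin n) (Fin n) ℝ)
    (π : StationaryPolicy) : Prop :=
  ∃ J : ℝ≥0∞, ∀ s,
    Tendsto (env.avgCost B K Q (env.policyActions π s) s) atTop (𝓝 J) ∧
    ∀ a, env.Admissible a → J ≤ liminf (env.avgCost B K Q a s) atTop

end Environment

end HalfDuplex

/-!
# Optimal half-duplex scheduling and the stabilizability threshold

Write `c φ = tr (Q F(φ))`. Because `BK = -A`, a received command replaces the plant state by the
estimation error and a received measurement resets the estimation error, while every slot applies
`A` and adds a fresh disturbance. Hence, conditionally on the channels and the private randomness,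
the second moments of the plant state and of the estimation error are `F(φ_k)` and `F(τ_k)`
(`Environment.Causal.hasAge`), and the expected stage cost is `E[c(φ_k)]`
(`Environment.Causal.lintegral_cost`). What remains is a Markov decision process on the countable
state space of pairs `(τ, φ)` with unbounded cost, where `c φ` is a sum over `i < φ` of increments
that grow at least like `ρ(A)²ⁱ`, and at most like `rⁱ` for every `r > ρ(A)²` (Gelfand's formula).

*Necessity.* Whatever the actions, `φ_k > i` has probability at least `pcⁱ` when `i ≤ k`, since only
downlink successes reset `φ`, and at least `psⁱ`, since `φ ≥ τ` and only uplink successes reset `τ`.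
If `p ρ(A)² ≥ 1` for one of the two error probabilities `p`, then every increment with `i ≤ k`
contributes at least a fixed amount to `E[c(φ_k)]`, which therefore grows at least linearly in `k`
(`Environment.Causal.limsup_avgCost_eq_top`).

*Sufficiency.* If `max ps pc < 1 / r` for some `r > ρ(A)²`, then listening while `φ = τ` and
transmitting commands while `φ > τ` reaches the reference state `(2, 2)` at an expected cost which
is at most affine in `c φ`; this is witnessed by an explicit Lyapunov function (`exists_lyapunov`).
It bounds the discounted value functions relative to their value at `(2, 2)` from above, uniformly
in the discount factor. Monotonicity of the values in `(τ, φ)` bounds them from below. A limit along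
an ultrafilter for vanishing discount then solves the average-cost optimality equation
`J + h = c + min_a E_a h` with `h` bounded below and `h ≤ D (1 + c)`
(`exists_averageCost_solution`).

Summing the equation along a trajectory shows that the minimizing policy has average cost at most
`J`, as `h` is bounded below. Under any other scheduling sequence the total cost up to time `N` is
at least `N J` minus a constant multiple of `1 + E[c(φ_N)]`. If the average cost at a time `N` is
small, then the last term is bounded on average over a short window before `N`, so that `J` bounds
even the lower limit of the average costs (`le_liminf_average`).
-/

namespace HalfDuplex

/-! ### Growth of the stage cost -/

section Growth

variable {n : ℕ}

/-- The expected stage cost `tr (Q F(φ))` of a state-quality indicator `φ`. -/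
def stageCost (A Q R : Matrix (Fin n) (Fin n) ℝ) (φ : ℕ) : ℝ := (Q * covF A R φ).trace

/-- The increment `tr (Q Aⁱ R (Aᵀ)ⁱ)` of the stage cost. -/
def costIncr (A Q R : Matrix (Fin n) (Fin n) ℝ) (i : ℕ) : ℝ := (Q * (A ^ i * R * Aᵀ ^ i)).trace

lemma stageCost_eq_sum (A Q R : Matrix (Fin n) (Fin n) ℝ) (φ : ℕ) :
    stageCost A Q R φ = ∑ i ∈ Finset.range φ, costIncr A Q R i := by
  simp [stageCost, covF, costIncr, Finset.mul_sum, Matrix.trace_sum]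

-- The Frobenius norm is submultiplicative, and its square is the trace that defines the cost.
attribute [local instance] Matrix.frobeniusNormedRing Matrix.frobeniusNormedAlgebra

lemma frobenius_norm_sq (M : Matrix (Fin n) (Fin n) ℝ) : ‖M‖ ^ 2 = (M * Mᵀ).trace := by
  rw [Matrix.frobenius_norm_def, ← Real.rpow_natCast, ← Real.rpow_mul]
  · simp [Matrix.trace, Matrix.mul_apply, pow_two]
  · positivity

lemma exists_isUnit_transpose_mul_self {Q : Matrix (Fin n) (Fin n) ℝ} (hQ : Q.PosDef) :
    ∃ S : Matrix (Fin n) (Fin n) ℝ, IsUnit S ∧ Q = Sᵀ * S := by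
  open scoped MatrixOrder in
  have hsq : CFC.sqrt Q * CFC.sqrt Q = Q := CFC.sqrt_mul_sqrt_self Q hQ.posSemidef.nonneg
  open scoped MatrixOrder in
  have hsa : (CFC.sqrt Q)ᵀ = CFC.sqrt Q := by
    have h := (CFC.sqrt_nonneg Q).isSelfAdjoint
    rwa [IsSelfAdjoint, Matrix.star_eq_conjTranspose,
      Matrix.conjTranspose_eq_transpose_of_trivial] at h
  open scoped MatrixOrder in
  refine ⟨CFC.sqrt Q, ?_, by rw [hsa, hsq]⟩
  have hu := hQ.isUnit
  rw [← hsq, Matrix.isUnit_iff_isUnit_det, Matrix.det_mul] at hu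
  exact (Matrix.isUnit_iff_isUnit_det _).2 (isUnit_of_mul_isUnit_left hu)

/-- Up to constants, the cost increments are the squared norms of the powers of `A`. -/
lemma exists_costIncr_bounds {A Q R : Matrix (Fin n) (Fin n) ℝ} (hQ : Q.PosDef) (hR : R.PosDef) :
    ∃ C > 0, ∀ i, costIncr A Q R i ≤ C * ‖A ^ i‖ ^ 2 ∧ ‖A ^ i‖ ^ 2 ≤ C * costIncr A Q R i := by
  obtain ⟨S, hS, rfl⟩ := exists_isUnit_transpose_mul_self hQ
  obtain ⟨T, hT, rfl⟩ := exists_isUnit_transpose_mul_self hR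
  have key : ∀ i, costIncr A (Sᵀ * S) (Tᵀ * T) i = ‖S * A ^ i * Tᵀ‖ ^ 2 := by
    intro i
    rw [frobenius_norm_sq, costIncr, Matrix.mul_assoc, Matrix.trace_mul_comm]
    simp only [Matrix.transpose_mul, Matrix.transpose_pow, Matrix.transpose_transpose,
      Matrix.mul_assoc]
  obtain ⟨u, rfl⟩ := hS
  obtain ⟨v, hv⟩ := (Matrix.isUnit_transpose T).2 hT
  replace key : ∀ i, costIncr A ((u : Matrix (Fin n) (Fin n) ℝ)ᵀ * u) (Tᵀ * T) i =
      ‖(u : Matrix (Fin n) (Fin n) ℝ) * A ^ i * v‖ ^ 2 := fun i => by rw [key, hv]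
  set U : Matrix (Fin n) (Fin n) ℝ := ↑u⁻¹
  set V : Matrix (Fin n) (Fin n) ℝ := ↑v⁻¹
  refine ⟨(‖(u : Matrix (Fin n) (Fin n) ℝ)‖ * ‖(v : Matrix (Fin n) (Fin n) ℝ)‖) ^ 2
    + (‖U‖ * ‖V‖) ^ 2 + 1, by positivity, fun i => ?_⟩
  have h1 : ‖(u : Matrix (Fin n) (Fin n) ℝ) * A ^ i * v‖
      ≤ (‖(u : Matrix (Fin n) (Fin n) ℝ)‖ * ‖(v : Matrix (Fin n) (Fin n) ℝ)‖) * ‖A ^ i‖ := by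
    calc _ ≤ ‖(u : Matrix (Fin n) (Fin n) ℝ)‖ * ‖A ^ i‖ * ‖(v : Matrix (Fin n) (Fin n) ℝ)‖ :=
          norm_mul₃_le
      _ = _ := by ring
  have h2 : ‖A ^ i‖ ≤ (‖U‖ * ‖V‖) * ‖(u : Matrix (Fin n) (Fin n) ℝ) * A ^ i * v‖ := by
    calc ‖A ^ i‖ = ‖U * ((u : Matrix (Fin n) (Fin n) ℝ) * A ^ i * v) * V‖ := by
          rw [← mul_assoc, ← mul_assoc, Units.inv_mul, one_mul, mul_assoc, Units.mul_inv, mul_one]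
      _ ≤ ‖U‖ * ‖(u : Matrix (Fin n) (Fin n) ℝ) * A ^ i * v‖ * ‖V‖ := norm_mul₃_le
      _ = _ := by ring
  have h3 := pow_le_pow_left₀ (norm_nonneg _) h1 2
  have h4 := pow_le_pow_left₀ (norm_nonneg _) h2 2
  rw [mul_pow] at h3 h4
  rw [key]
  constructor
  · nlinarith [sq_nonneg (‖U‖ * ‖V‖), sq_nonneg ‖A ^ i‖,
      mul_nonneg (sq_nonneg (‖U‖ * ‖V‖)) (sq_nonneg ‖A ^ i‖)]
  · nlinarith [sq_nonneg ‖(u : Matrix (Fin n) (Fin n) ℝ) * A ^ i * v‖,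
      mul_nonneg (sq_nonneg (‖(u : Matrix (Fin n) (Fin n) ℝ)‖ *
        ‖(v : Matrix (Fin n) (Fin n) ℝ)‖))
        (sq_nonneg ‖(u : Matrix (Fin n) (Fin n) ℝ) * A ^ i * v‖)]

lemma norm_map_pow (A : Matrix (Fin n) (Fin n) ℝ) (i : ℕ) :
    ‖(A.map (algebraMap ℝ ℂ)) ^ i‖ = ‖A ^ i‖ := by
  rw [← Matrix.frobenius_norm_map_eq (A ^ i) (algebraMap ℝ ℂ) (by simp)]
  congr 1
  exact (map_pow (algebraMap ℝ ℂ).mapMatrix A i).symm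

/-- The upper bound on the growth of powers that Gelfand's formula gives. -/
lemma exists_norm_pow_le {A : Matrix (Fin n) (Fin n) ℝ} {r : ℝ} (hA : 0 < specRadius A)
    (hr : specRadius A < r) : ∃ C > 0, ∀ i, ‖A ^ i‖ ≤ C * r ^ i := by
  have hr0 : 0 < r := hA.trans hr
  have hfin : spectralRadius ℂ (A.map (algebraMap ℝ ℂ)) ≠ ⊤ := (ENNReal.toReal_pos_iff.1 hA).2.ne
  have hlt : spectralRadius ℂ (A.map (algebraMap ℝ ℂ)) < ENNReal.ofReal r :=
    (ENNReal.lt_ofReal_iff_toReal_lt hfin).2 hr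
  have hev := (spectrum.pow_nnnorm_pow_one_div_tendsto_nhds_spectralRadius
    (A.map (algebraMap ℝ ℂ))).eventually_lt_const hlt
  have hev' : ∀ᶠ i : ℕ in atTop, ‖A ^ i‖ ≤ r ^ i := by
    filter_upwards [hev, eventually_gt_atTop 0] with i hi hi0
    rw [one_div, ENNReal.rpow_inv_lt_iff (by exact_mod_cast hi0), ENNReal.rpow_natCast,
      ← ENNReal.ofReal_pow hr0.le, ← enorm_eq_nnnorm, ← ofReal_norm, norm_map_pow] at hi
    exact ((ENNReal.ofReal_lt_ofReal_iff (by positivity)).1 hi).le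
  obtain ⟨N, hN⟩ := eventually_atTop.1 hev'
  refine ⟨1 + ∑ i ∈ Finset.range N, ‖A ^ i‖ / r ^ i, by positivity, fun i => ?_⟩
  rcases lt_or_ge i N with h | h
  · have h1 : ‖A ^ i‖ / r ^ i ≤ ∑ i ∈ Finset.range N, ‖A ^ i‖ / r ^ i :=
      Finset.single_le_sum (f := fun i => ‖A ^ i‖ / r ^ i) (fun j _ => by positivity)
        (Finset.mem_range.2 h)
    rw [← div_le_iff₀ (by positivity)]
    linarith
  · refine (hN i h).trans (le_mul_of_one_le_left (by positivity) ?_)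
    have : 0 ≤ ∑ i ∈ Finset.range N, ‖A ^ i‖ / r ^ i := by positivity
    linarith

/-- The spectral radius of a power is at most its norm, up to the norm of the identity, which is not
`1` for the Frobenius norm. -/
lemma exists_specRadius_pow_le {A : Matrix (Fin n) (Fin n) ℝ} (hA : 0 < specRadius A) :
    ∃ C > 0, ∀ i, specRadius A ^ i ≤ C * ‖A ^ i‖ := by
  have hfin : spectralRadius ℂ (A.map (algebraMap ℝ ℂ)) ≠ ⊤ := (ENNReal.toReal_pos_iff.1 hA).2.ne
  have hsucc : ∀ i, specRadius A ^ (i + 1)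
      ≤ ‖(1 : Matrix (Fin n) (Fin n) ℂ)‖ * ‖A ^ (i + 1)‖ := by
    intro i
    have h := spectrum.spectralRadius_le_pow_nnnorm_pow_one_div ℂ (A.map (algebraMap ℝ ℂ)) i
    rw [← ENNReal.mul_rpow_of_nonneg _ _ (by positivity), one_div,
      show (i : ℝ) + 1 = ((i + 1 : ℕ) : ℝ) by push_cast; rfl,
      ENNReal.le_rpow_inv_iff (by positivity), ENNReal.rpow_natCast] at h
    have h' := ENNReal.toReal_mono (by finiteness) h
    rw [ENNReal.toReal_pow, ENNReal.toReal_mul] at h'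
    simp only [ENNReal.coe_toReal, coe_nnnorm] at h'
    rw [norm_map_pow, mul_comm] at h'
    exact h'
  have hone : (1 : ℝ) ≤ (1 + ‖(1 : Matrix (Fin n) (Fin n) ℝ)‖⁻¹) *
      ‖(1 : Matrix (Fin n) (Fin n) ℝ)‖ := by
    -- For `n = 0` the spectral radius would be zero.
    have : Nontrivial (Matrix (Fin n) (Fin n) ℝ) := by
      by_contra h
      rw [not_nontrivial_iff_subsingleton] at h
      have hn : IsEmpty (Fin n) := by
        by_contra hn
        rw [not_isEmpty_iff] at hn
        exact not_subsingleton (Matrix (Fin n) (Fin n) ℝ) h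
      rw [specRadius, spectrum.SpectralRadius.of_subsingleton] at hA
      simp at hA
    rw [add_mul, inv_mul_cancel₀ (by simp), one_mul]
    linarith [norm_nonneg (1 : Matrix (Fin n) (Fin n) ℝ)]
  refine ⟨1 + ‖(1 : Matrix (Fin n) (Fin n) ℝ)‖⁻¹ + ‖(1 : Matrix (Fin n) (Fin n) ℂ)‖,
    by positivity, fun i => ?_⟩
  cases i with
  | zero =>
    rw [pow_zero, pow_zero, add_mul]
    exact hone.trans (le_add_of_nonneg_right (by positivity))
  | succ i =>
    rw [add_mul]
    exact (hsucc i).trans (le_add_of_nonneg_left (by positivity))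

lemma costIncr_nonneg {A Q R : Matrix (Fin n) (Fin n) ℝ} (hQ : Q.PosDef) (hR : R.PosDef) (i : ℕ) :
    0 ≤ costIncr A Q R i := by
  obtain ⟨C, hC, h⟩ := exists_costIncr_bounds (A := A) hQ hR
  exact nonneg_of_mul_nonneg_right ((sq_nonneg _).trans (h i).2) hC

lemma stageCost_nonneg {A Q R : Matrix (Fin n) (Fin n) ℝ} (hQ : Q.PosDef) (hR : R.PosDef)
    (φ : ℕ) : 0 ≤ stageCost A Q R φ := by
  rw [stageCost_eq_sum]
  exact Finset.sum_nonneg fun i _ => costIncr_nonneg hQ hR i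

lemma stageCost_mono {A Q R : Matrix (Fin n) (Fin n) ℝ} (hQ : Q.PosDef) (hR : R.PosDef) :
    Monotone (stageCost A Q R) := by
  refine monotone_nat_of_le_succ fun φ => ?_
  rw [stageCost_eq_sum, stageCost_eq_sum, Finset.sum_range_succ]
  exact le_add_of_nonneg_right (costIncr_nonneg hQ hR φ)

/-- The cost increments grow at least like `ρ(A)²ⁱ`. -/
lemma exists_le_costIncr {A Q R : Matrix (Fin n) (Fin n) ℝ} (hA : 0 < specRadius A)
    (hQ : Q.PosDef) (hR : R.PosDef) :
    ∃ κ > 0, ∀ i, κ * (specRadius A ^ 2) ^ i ≤ costIncr A Q R i := by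
  obtain ⟨C, hC, h⟩ := exists_costIncr_bounds (A := A) hQ hR
  obtain ⟨D, hD, h'⟩ := exists_specRadius_pow_le hA
  refine ⟨(C * D ^ 2)⁻¹, by positivity, fun i => ?_⟩
  rw [inv_mul_le_iff₀ (by positivity), pow_right_comm]
  calc (specRadius A ^ i) ^ 2 ≤ (D * ‖A ^ i‖) ^ 2 :=
        pow_le_pow_left₀ (by positivity) (h' i) 2
    _ = D ^ 2 * ‖A ^ i‖ ^ 2 := mul_pow _ _ _
    _ ≤ D ^ 2 * (C * costIncr A Q R i) := by gcongr; exact (h i).2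
    _ = _ := by ring

/-- For every rate `r > ρ(A)²`, ageing by `k` slots multiplies the stage cost by at most a constant
times `rᵏ`. -/
lemma exists_stageCost_add_le {A Q R : Matrix (Fin n) (Fin n) ℝ} (hA : 1 < specRadius A)
    (hQ : Q.PosDef) (hR : R.PosDef) {r : ℝ} (hr : specRadius A ^ 2 < r) :
    ∃ C > 0, ∀ φ k, stageCost A Q R (φ + k) ≤ C * r ^ k * (1 + stageCost A Q R φ) := by
  have hr1 : 1 < r := (one_lt_pow₀ hA two_ne_zero).trans hr
  have hr0 : 0 < r := by linarith
  obtain ⟨C, hC, h⟩ := exists_costIncr_bounds (A := A) hQ hR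
  obtain ⟨D, hD, h'⟩ := exists_norm_pow_le (r := √r) (zero_lt_one.trans hA)
    (Real.lt_sqrt_of_sq_lt hr)
  have hg : ∀ i k, costIncr A Q R (i + k) ≤ (C * D * C * D) * r ^ k * costIncr A Q R i := by
    intro i k
    calc costIncr A Q R (i + k) ≤ C * ‖A ^ (i + k)‖ ^ 2 := (h _).1
      _ ≤ C * (‖A ^ i‖ * ‖A ^ k‖) ^ 2 := by rw [pow_add]; gcongr; exact norm_mul_le _ _
      _ = C * (‖A ^ i‖ ^ 2 * ‖A ^ k‖ ^ 2) := by rw [mul_pow]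
      _ ≤ C * ((C * costIncr A Q R i) * (D * √r ^ k) ^ 2) := by
          gcongr
          · exact mul_nonneg hC.le (costIncr_nonneg hQ hR i)
          · exact (h i).2
          · exact h' k
      _ = (C * D * C * D) * (√r ^ 2) ^ k * costIncr A Q R i := by ring
      _ = _ := by rw [Real.sq_sqrt hr0.le]
  set E := C * D * C * D
  have hE : 0 < E := by positivity
  have hg0 := costIncr_nonneg (A := A) hQ hR 0
  have hk : ∀ k, stageCost A Q R k ≤ E * costIncr A Q R 0 / (r - 1) * r ^ k := by
    intro k
    rw [stageCost_eq_sum]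
    calc ∑ i ∈ Finset.range k, costIncr A Q R i
        ≤ ∑ i ∈ Finset.range k, E * costIncr A Q R 0 * r ^ i :=
          Finset.sum_le_sum fun i _ => by simpa [mul_right_comm] using hg 0 i
      _ = E * costIncr A Q R 0 * ((r ^ k - 1) / (r - 1)) := by
          rw [← Finset.mul_sum, geom_sum_eq hr1.ne']
      _ ≤ E * costIncr A Q R 0 * (r ^ k / (r - 1)) := by
          have : 0 < r - 1 := by linarith
          gcongr
          linarith
      _ = _ := by ring
  have hr1' : 0 < r - 1 := by linarith
  refine ⟨E * costIncr A Q R 0 / (r - 1) + E, by positivity, fun φ k => ?_⟩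
  have hsum : stageCost A Q R (φ + k)
      ≤ stageCost A Q R k + E * r ^ k * stageCost A Q R φ := by
    rw [stageCost_eq_sum, stageCost_eq_sum, stageCost_eq_sum, add_comm φ k,
      Finset.sum_range_add, Finset.mul_sum]
    gcongr with i
    rw [add_comm k i]
    exact hg i k
  have hφ := stageCost_nonneg (A := A) hQ hR φ
  have : 0 ≤ E * r ^ k := by positivity
  have : 0 ≤ E * costIncr A Q R 0 / (r - 1) * r ^ k * stageCost A Q R φ := by positivity
  nlinarith [hk k]

end Growth

/-! ### Transitions of the indicators and a Lyapunov function -/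

section Bellman

/-- The expected value of `V` at the next state when action `a` is taken in state `s`. The state of
the channel that `a` does not use is set to `true`; `step` ignores it. -/
def expNext (ps pc : ℝ) (a : Action) (V : stateSpace → ℝ) (s : stateSpace) : ℝ :=
  match a with
  | .sensor => (1 - ps) * V (step .sensor true true s) + ps * V (step .sensor false true s)
  | .controller =>
    (1 - pc) * V (step .controller true true s) + pc * V (step .controller true false s)

lemma expNext_mono {ps pc : ℝ} (hps : ps ∈ Set.Ioo (0 : ℝ) 1) (hpc : pc ∈ Set.Ioo (0 : ℝ) 1)
    (a : Action) {V W : stateSpace → ℝ} (h : ∀ s, V s ≤ W s) (s : stateSpace) :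
    expNext ps pc a V s ≤ expNext ps pc a W s := by
  obtain ⟨h1, h2⟩ := hps
  obtain ⟨h3, h4⟩ := hpc
  have : 0 ≤ 1 - ps := by linarith
  have : 0 ≤ 1 - pc := by linarith
  cases a <;> simp only [expNext] <;> gcongr <;> exact h _

lemma expNext_add_const (ps pc : ℝ) (a : Action) (V : stateSpace → ℝ) (b : ℝ) (s : stateSpace) :
    expNext ps pc a (fun t => V t + b) s = expNext ps pc a V s + b := by
  cases a <;> simp only [expNext] <;> ring

lemma expNext_const (ps pc : ℝ) (a : Action) (b : ℝ) (s : stateSpace) :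
    expNext ps pc a (fun _ => b) s = b := by
  cases a <;> simp only [expNext] <;> ring

lemma step_mono (a : Action) (up dn : Bool) : Monotone (step a up dn) := by
  rintro ⟨⟨τ, φ⟩, hs⟩ ⟨⟨τ', φ'⟩, hs'⟩ h
  have h' : τ ≤ τ' ∧ φ ≤ φ' := h
  change _ ∧ _
  cases a <;> cases up <;> cases dn <;> simp [step] <;> omega

lemma monotone_expNext {ps pc : ℝ} (hps : ps ∈ Set.Ioo (0 : ℝ) 1) (hpc : pc ∈ Set.Ioo (0 : ℝ) 1)
    (a : Action) {V : stateSpace → ℝ} (hV : Monotone V) : Monotone (expNext ps pc a V) := by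
  obtain ⟨h1, h2⟩ := hps
  obtain ⟨h3, h4⟩ := hpc
  have : 0 ≤ 1 - ps := by linarith
  have : 0 ≤ 1 - pc := by linarith
  intro s t hst
  cases a <;> simp only [expNext] <;> gcongr <;> exact hV (step_mono _ _ _ hst)

/-- The reference state `(2, 2)`. -/
def refState : stateSpace := ⟨(2, 2), by simp [stateSpace]⟩

/-- A sequence which grows at most like `r ^ k` from everywhere has a majorant of the same size
whose one-step growth factor is at most `r`. -/
lemma exists_growth_majorant {c : ℕ → ℝ} (hmono : Monotone c) {r C : ℝ}
    (hr : 1 < r) (hgrow : ∀ φ k, c (φ + k) ≤ C * r ^ k * (1 + c φ)) :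
    ∃ q : ℕ → ℝ, (∀ φ, c φ ≤ q φ) ∧ (∀ φ, q φ ≤ C * (1 + c φ)) ∧
      (∀ φ, q (φ + 1) ≤ r * q φ) ∧ Monotone q := by
  have hr0 : 0 < r := by linarith
  have hle : ∀ φ k, c (φ + k) / r ^ k ≤ C * (1 + c φ) := fun φ k => by
    rw [div_le_iff₀ (by positivity)]
    linarith [hgrow φ k]
  have hbdd : ∀ φ, BddAbove (Set.range fun k => c (φ + k) / r ^ k) := fun φ =>
    ⟨C * (1 + c φ), by rintro _ ⟨k, rfl⟩; exact hle φ k⟩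
  refine ⟨fun φ => ⨆ k, c (φ + k) / r ^ k, fun φ => ?_, fun φ => ciSup_le (hle φ), fun φ => ?_,
    fun φ ψ h => ?_⟩
  · simpa using le_ciSup (hbdd φ) 0
  · refine ciSup_le fun k => ?_
    have := le_ciSup (hbdd φ) (k + 1)
    calc c (φ + 1 + k) / r ^ k = r * (c (φ + (k + 1)) / r ^ (k + 1)) := by
          rw [add_right_comm, add_assoc φ, pow_succ]; field_simp
      _ ≤ _ := by gcongr
  · refine ciSup_mono (hbdd ψ) fun k => ?_
    gcongr
    exact hmono (by omega)

/-- A Lyapunov function for the policy which listens to the sensor if `φ = τ` and commands the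
actuator if `φ > τ`: it bounds the expected cost until the reference state is next visited. -/
lemma exists_lyapunov {c : ℕ → ℝ} (hc : ∀ φ, 0 ≤ c φ) (hmono : Monotone c) {r C ps pc : ℝ}
    (hps : ps ∈ Set.Ioo (0 : ℝ) 1) (hpc : pc ∈ Set.Ioo (0 : ℝ) 1)
    (hr : 1 < r) (hpsr : ps * r < 1) (hpcr : pc * r < 1)
    (hgrow : ∀ φ k, c (φ + k) ≤ C * r ^ k * (1 + c φ)) :
    ∃ (π : StationaryPolicy) (W : stateSpace → ℝ) (D : ℝ), 0 ≤ D ∧ (∀ s, 0 ≤ W s) ∧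
      (∀ s, W s ≤ D * (1 + c s.1.2)) ∧
      ∀ s, c s.1.2 + expNext ps pc (π s) (fun t => if t = refState then 0 else W t) s ≤ W s := by
  obtain ⟨q, hcq, hqC, hq, hqm⟩ := exists_growth_majorant hmono hr hgrow
  obtain ⟨h1, h2⟩ := hps
  obtain ⟨h3, h4⟩ := hpc
  have hq0 : ∀ φ, 0 ≤ q φ := fun φ => (hc φ).trans (hcq φ)
  have hC : 0 ≤ C := by
    have := (hq0 0).trans (hqC 0)
    exact nonneg_of_mul_nonneg_left this (by linarith [hc 0])
  have hd1 : 0 < 1 - pc * r := by linarith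
  have hd2 : 0 < 1 - ps * r := by linarith
  have hps' : 0 < 1 - ps := by linarith
  have hpc' : 0 < 1 - pc := by linarith
  -- `W` is `y q(τ) + l` on the diagonal and `x q(φ) + z q(τ) + l` off it. The drift inequality
  -- holds if `x`, `y`, `z` solve the linear equations below, which is possible as `pc r, ps r < 1`.
  -- At `τ = 1` a success leads to `(2, 2)`, where nothing remains to be paid; there the constant
  -- `l` is lowered to `pc l`, and this pays for the term `z q(1)` when a measurement arrives.
  obtain ⟨x, hx0, hx⟩ : ∃ x, 0 ≤ x ∧ 1 + pc * r * x = x :=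
    ⟨1 / (1 - pc * r), by positivity, by field_simp; ring⟩
  obtain ⟨y, hy0, hy⟩ : ∃ y, 0 ≤ y ∧ 1 + ps * r * y + (1 - ps) * r * x = y :=
    ⟨(1 + (1 - ps) * r * x) / (1 - ps * r), by positivity, by field_simp; ring⟩
  obtain ⟨z, hz0, hz⟩ : ∃ z, 0 ≤ z ∧ pc * r * z + (1 - pc) * r * y = z :=
    ⟨(1 - pc) * r * y / (1 - pc * r), by positivity, by field_simp; ring⟩
  obtain ⟨l, hl0, hl⟩ : ∃ l, 0 ≤ l ∧ z * q 1 + pc * l = l :=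
    ⟨z * q 1 / (1 - pc), div_nonneg (mul_nonneg hz0 (hq0 1)) hpc'.le, by field_simp; ring⟩
  let W : ℕ → ℕ → ℝ := fun τ φ =>
    if φ = τ then y * q τ + l else x * q φ + z * q τ + (if τ = 1 then pc * l else l)
  have hW0 : ∀ τ φ, 0 ≤ W τ φ := by
    intro τ φ
    have := mul_nonneg hx0 (hq0 φ)
    have := mul_nonneg hy0 (hq0 τ)
    have := mul_nonneg hz0 (hq0 τ)
    have := mul_nonneg h3.le hl0
    simp only [W]
    split_ifs <;> linarith
  refine ⟨fun s => if s.1.2 = s.1.1 then .sensor else .controller, fun s => W s.1.1 s.1.2,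
    (x + y + z) * C + l, by positivity, fun s => hW0 _ _, ?_, ?_⟩
  · rintro ⟨⟨τ, φ⟩, hs1, hs2, hs3, hs4⟩
    simp only at hs1 hs2 hs3 hs4 ⊢
    have hqq := hqm hs3
    have e1 := mul_le_mul_of_nonneg_left (hqC φ) hx0
    have e2 := mul_le_mul_of_nonneg_left (hqq.trans (hqC φ)) hy0
    have e3 := mul_le_mul_of_nonneg_left (hqq.trans (hqC φ)) hz0
    have e4 : l ≤ l * (1 + c φ) := le_mul_of_one_le_right hl0 (by linarith [hc φ])
    have e5 : pc * l ≤ l := mul_le_of_le_one_left hl0 h4.le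
    have := mul_nonneg hx0 (hq0 φ)
    have := mul_nonneg hy0 (hq0 τ)
    have := mul_nonneg hz0 (hq0 τ)
    simp only [W]
    split_ifs <;> linarith
  · rintro ⟨⟨τ, φ⟩, hs⟩
    have hs' := hs
    obtain ⟨hs1, hs2, hs3, hs4⟩ := hs
    simp only at hs1 hs2 hs3 hs4 ⊢
    have hcut : ∀ t : stateSpace,
        (if t = refState then 0 else W t.1.1 t.1.2) ≤ W t.1.1 t.1.2 := by
      intro t; split_ifs
      · exact hW0 _ _
      · exact le_rfl
    rcases hs3.eq_or_lt with rfl | hlt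
    · simp only [if_true, expNext]
      have e1 := hcut (step .sensor true true ⟨(τ, τ), hs'⟩)
      have e2 := hcut (step .sensor false true ⟨(τ, τ), hs'⟩)
      have v1 : W (step .sensor true true ⟨(τ, τ), hs'⟩).1.1
          (step .sensor true true ⟨(τ, τ), hs'⟩).1.2 = x * q (τ + 1) + z * q 1 + pc * l := by
        simp [step, W]; omega
      have v2 : W (step .sensor false true ⟨(τ, τ), hs'⟩).1.1
          (step .sensor false true ⟨(τ, τ), hs'⟩).1.2 = y * q (τ + 1) + l := by
        simp [step, W]
      have v3 : W τ τ = y * q τ + l := by simp [W]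
      rw [v3]
      have f1 := mul_le_mul_of_nonneg_left (e1.trans_eq v1) hps'.le
      have f2 := mul_le_mul_of_nonneg_left (e2.trans_eq v2) h1.le
      have g1 := mul_le_mul_of_nonneg_left (hq τ) (mul_nonneg hps'.le hx0)
      have g2 := mul_le_mul_of_nonneg_left (hq τ) (mul_nonneg h1.le hy0)
      have := hcq τ
      have k1 : (1 - ps) * (z * q 1 + pc * l) = (1 - ps) * l := by rw [hl]
      have k2 : (1 + ps * r * y + (1 - ps) * r * x) * q τ = y * q τ := by rw [hy]
      linarith
    · have hne : φ ≠ τ := hlt.ne'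
      simp only [if_neg hne, expNext]
      have e2 := hcut (step .controller true false ⟨(τ, φ), hs'⟩)
      have v2 : W (step .controller true false ⟨(τ, φ), hs'⟩).1.1
          (step .controller true false ⟨(τ, φ), hs'⟩).1.2
          = x * q (φ + 1) + z * q (τ + 1) + l := by
        simp [step, W, hne]; omega
      have v3 : W τ φ = x * q φ + z * q τ + (if τ = 1 then pc * l else l) := by simp [W, hne]
      have e1 : (if step .controller true true ⟨(τ, φ), hs'⟩ = refState then 0
          else W (step .controller true true ⟨(τ, φ), hs'⟩).1.1
            (step .controller true true ⟨(τ, φ), hs'⟩).1.2)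
          ≤ y * q (τ + 1) + (if τ = 1 then 0 else l) := by
        by_cases hτ : τ = 1
        · subst hτ
          rw [if_pos (Subtype.ext (by simp [step, refState]))]
          simpa using mul_nonneg hy0 (hq0 _)
        · refine (hcut _).trans ?_
          simp [step, W, hτ]
      rw [v3]
      have f1 := mul_le_mul_of_nonneg_left e1 hpc'.le
      have f2 := mul_le_mul_of_nonneg_left (e2.trans_eq v2) h3.le
      have g1 := mul_le_mul_of_nonneg_left (hq φ) (mul_nonneg h3.le hx0)
      have g2 := mul_le_mul_of_nonneg_left (hq τ) (mul_nonneg h3.le hz0)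
      have g3 := mul_le_mul_of_nonneg_left (hq τ) (mul_nonneg hpc'.le hy0)
      have := hcq φ
      have k1 : (1 + pc * r * x) * q φ = x * q φ := by rw [hx]
      have k2 : (pc * r * z + (1 - pc) * r * y) * q τ = z * q τ := by rw [hz]
      by_cases hτ : τ = 1
      · rw [if_pos hτ] at f1 ⊢
        linarith
      · rw [if_neg hτ] at f1 ⊢
        linarith

end Bellman

/-! ### The average-cost optimality equation -/

section Bellman

/-- The dynamic programming operator with stage cost `c φ` and discount factor `α`. -/
noncomputable def bellman (ps pc : ℝ) (c : ℕ → ℝ) (α : ℝ) (V : stateSpace → ℝ) (s : stateSpace) :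
    ℝ :=
  c s.1.2 + α * min (expNext ps pc .sensor V s) (expNext ps pc .controller V s)

variable {ps pc : ℝ} {c : ℕ → ℝ}

lemma bellman_le {α : ℝ} (hα : 0 ≤ α) (a : Action) (V : stateSpace → ℝ) (s : stateSpace) :
    bellman ps pc c α V s ≤ c s.1.2 + α * expNext ps pc a V s := by
  unfold bellman
  gcongr
  cases a
  · exact min_le_left _ _
  · exact min_le_right _ _

lemma bellman_mono (hps : ps ∈ Set.Ioo (0 : ℝ) 1) (hpc : pc ∈ Set.Ioo (0 : ℝ) 1) {α : ℝ}
    (hα : 0 ≤ α) {V W : stateSpace → ℝ} (h : ∀ s, V s ≤ W s) (s : stateSpace) :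
    bellman ps pc c α V s ≤ bellman ps pc c α W s := by
  unfold bellman
  gcongr
  · exact expNext_mono hps hpc _ h s
  · exact expNext_mono hps hpc _ h s

lemma monotone_bellman (hps : ps ∈ Set.Ioo (0 : ℝ) 1) (hpc : pc ∈ Set.Ioo (0 : ℝ) 1)
    (hmono : Monotone c) {α : ℝ} (hα : 0 ≤ α) {V : stateSpace → ℝ} (hV : Monotone V) :
    Monotone (bellman ps pc c α V) := by
  intro s t hst
  unfold bellman
  gcongr
  · exact hmono hst.2
  · exact monotone_expNext hps hpc _ hV hst
  · exact monotone_expNext hps hpc _ hV hst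

lemma bellman_nonneg (hps : ps ∈ Set.Ioo (0 : ℝ) 1) (hpc : pc ∈ Set.Ioo (0 : ℝ) 1)
    (hc : ∀ φ, 0 ≤ c φ) {α : ℝ} (hα : 0 ≤ α) {V : stateSpace → ℝ} (hV : ∀ s, 0 ≤ V s)
    (s : stateSpace) : 0 ≤ bellman ps pc c α V s := by
  have h : ∀ a, 0 ≤ expNext ps pc a V s := fun a => by
    simpa [expNext_const] using expNext_mono hps hpc a hV s
  exact add_nonneg (hc _) (mul_nonneg hα (le_min (h _) (h _)))

lemma tendsto_expNext {ι : Type*} {l : Filter ι} {U : ι → stateSpace → ℝ} {V : stateSpace → ℝ}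
    (hU : ∀ s, Tendsto (fun i => U i s) l (𝓝 (V s))) (a : Action) (s : stateSpace) :
    Tendsto (fun i => expNext ps pc a (U i) s) l (𝓝 (expNext ps pc a V s)) := by
  cases a
  · exact ((hU _).const_mul _).add ((hU _).const_mul _)
  · exact ((hU _).const_mul _).add ((hU _).const_mul _)

lemma tendsto_bellman {ι : Type*} {l : Filter ι} {U : ι → stateSpace → ℝ} {V : stateSpace → ℝ}
    {β : ι → ℝ} {α : ℝ} (hβ : Tendsto β l (𝓝 α))
    (hU : ∀ s, Tendsto (fun i => U i s) l (𝓝 (V s))) (s : stateSpace) :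
    Tendsto (fun i => bellman ps pc c (β i) (U i) s) l (𝓝 (bellman ps pc c α V s)) :=
  (hβ.mul ((tendsto_expNext hU _ s).min (tendsto_expNext hU _ s))).const_add _

/-- The discounted value function, the limit of value iteration from `0`. It exceeds its value at
the reference state by at most the Lyapunov function `W`. -/
lemma exists_discounted_value (hc : ∀ φ, 0 ≤ c φ) (hmono : Monotone c)
    (hps : ps ∈ Set.Ioo (0 : ℝ) 1) (hpc : pc ∈ Set.Ioo (0 : ℝ) 1)
    {π : StationaryPolicy} {W : stateSpace → ℝ} (hW : ∀ s, 0 ≤ W s)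
    (hlyap : ∀ s,
      c s.1.2 + expNext ps pc (π s) (fun t => if t = refState then 0 else W t) s ≤ W s)
    {α : ℝ} (hα0 : 0 ≤ α) (hα1 : α < 1) :
    ∃ V : stateSpace → ℝ, (∀ s, 0 ≤ V s) ∧ Monotone V ∧ (∀ s, V s = bellman ps pc c α V s) ∧
      (∀ s, V s ≤ V refState + W s) ∧ (1 - α) * V refState ≤ W refState := by
  let U : ℕ → stateSpace → ℝ := fun k => (bellman ps pc c α)^[k] 0
  have hUs : ∀ k, U (k + 1) = bellman ps pc c α (U k) := fun k =>
    Function.iterate_succ_apply' _ _ _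
  have hU0 : ∀ k s, 0 ≤ U k s := by
    intro k
    induction k with
    | zero => intro s; exact le_rfl
    | succ k ih => intro s; rw [hUs]; exact bellman_nonneg hps hpc hc hα0 ih s
  have hUmono : ∀ k, Monotone (U k) := by
    intro k
    induction k with
    | zero => exact fun _ _ _ => le_rfl
    | succ k ih => rw [hUs]; exact monotone_bellman hps hpc hmono hα0 ih
  have hUstep : ∀ k s, U k s ≤ U (k + 1) s := by
    intro k
    induction k with
    | zero => intro s; exact hU0 1 s
    | succ k ih => intro s; rw [hUs, hUs (k + 1)]; exact bellman_mono hps hpc hα0 ih s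
  have hUk : ∀ s, Monotone fun k => U k s := fun s => monotone_nat_of_le_succ fun k => hUstep k s
  -- A bound `b` on the iterates at the reference state propagates to `b + W` everywhere.
  have hprop : ∀ b, (∀ V : stateSpace → ℝ, V refState ≤ b → (∀ s, V s ≤ b + W s) →
      ∀ s, bellman ps pc c α V s ≤ α * b + W s) := by
    intro b V hb hV s
    have h1 := bellman_le (ps := ps) (pc := pc) (c := c) hα0 (π s) V s
    have h2 : expNext ps pc (π s) V s
        ≤ expNext ps pc (π s) (fun t => if t = refState then 0 else W t) s + b := by
      rw [← expNext_add_const]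
      refine expNext_mono hps hpc _ (fun t => ?_) s
      split_ifs with h
      · simpa [h] using hb
      · linarith [hV t]
    have h0 : 0 ≤ expNext ps pc (π s) (fun t => if t = refState then 0 else W t) s := by
      refine (expNext_const ps pc (π s) 0 s).symm.trans_le (expNext_mono hps hpc _ (fun t => ?_) s)
      split_ifs
      · exact le_rfl
      · exact hW t
    have h3 := mul_le_mul_of_nonneg_left h2 hα0
    have h4 := mul_le_of_le_one_left h0 hα1.le
    linarith [hlyap s]
  set b₀ := W refState / (1 - α)
  have hb₀ : 0 ≤ b₀ := div_nonneg (hW _) (by linarith)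
  have hb₀' : α * b₀ + W refState = b₀ := by
    have : 1 - α ≠ 0 := by linarith
    simp only [b₀]; field_simp; ring
  have hUb : ∀ k, U k refState ≤ b₀ ∧ ∀ s, U k s ≤ b₀ + W s := by
    intro k
    induction k with
    | zero => exact ⟨hb₀, fun s => add_nonneg hb₀ (hW s)⟩
    | succ k ih =>
      rw [hUs]
      refine ⟨(hprop b₀ _ ih.1 ih.2 _).trans_eq hb₀', fun s => (hprop b₀ _ ih.1 ih.2 s).trans ?_⟩
      linarith [hW refState]
  have hbdd : ∀ s, BddAbove (Set.range fun k => U k s) := fun s =>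
    ⟨b₀ + W s, by rintro _ ⟨k, rfl⟩; exact (hUb k).2 s⟩
  set V : stateSpace → ℝ := fun s => ⨆ k, U k s
  have hlim : ∀ s, Tendsto (fun k => U k s) atTop (𝓝 (V s)) := fun s =>
    tendsto_atTop_ciSup (hUk s) (hbdd s)
  have hUV : ∀ k s, U k s ≤ V s := fun k s => le_ciSup (hbdd s) k
  have hVfix : ∀ s, V s = bellman ps pc c α V s := by
    intro s
    have h1 := tendsto_bellman (ps := ps) (pc := pc) (c := c)
      (tendsto_const_nhds (x := α) (f := (atTop : Filter ℕ))) hlim s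
    refine tendsto_nhds_unique ((tendsto_add_atTop_iff_nat 1).2 (hlim s)) ?_
    simpa only [hUs] using h1
  have hV0 : ∀ s, 0 ≤ V s := fun s => (hU0 0 s).trans (hUV 0 s)
  have hUW : ∀ k s, U k s ≤ V refState + W s := by
    intro k
    induction k with
    | zero => intro s; exact add_nonneg (hV0 _) (hW s)
    | succ k ih =>
      intro s
      rw [hUs]
      refine (hprop (V refState) _ (hUV k _) ih s).trans ?_
      linarith [mul_le_of_le_one_left (hV0 refState) hα1.le]
  have hVW : ∀ s, V s ≤ V refState + W s := fun s => ciSup_le fun k => hUW k s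
  refine ⟨V, hV0, fun s t hst => ciSup_mono (hbdd t) fun k => hUmono k hst, hVfix, hVW, ?_⟩
  have := hprop (V refState) V le_rfl hVW refState
  rw [← hVfix] at this
  linarith

/-- The discounted value at the reference state exceeds the value elsewhere by at most a constant:
the only states that do not dominate `(2, 2)` have `τ = 1`, they dominate `(1, 3)`, and every
successor of `(1, 3)` dominates `(2, 2)` or `(1, 3)`. -/
lemma discounted_value_refState_le (hc : ∀ φ, 0 ≤ c φ) (hps : ps ∈ Set.Ioo (0 : ℝ) 1)
    (hpc : pc ∈ Set.Ioo (0 : ℝ) 1) {α b : ℝ} (hα0 : 0 ≤ α) (hα1 : α < 1) {V : stateSpace → ℝ}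
    (hV : Monotone V) (hV0 : ∀ s, 0 ≤ V s) (hfix : ∀ s, V s = bellman ps pc c α V s)
    (hb : (1 - α) * V refState ≤ b) (s : stateSpace) : V refState ≤ V s + b / ps := by
  obtain ⟨h1, h2⟩ := hps
  obtain ⟨h3, h4⟩ := hpc
  have hb0 : 0 ≤ b := (mul_nonneg (by linarith) (hV0 _)).trans hb
  have hbp : b ≤ b / ps := le_div_self hb0 h1 h2.le
  set t : stateSpace := ⟨(1, 3), by simp [stateSpace]⟩
  have key : V refState ≤ V t + b / ps := by
    have e1 : V refState ≤ V (step .controller true true t) := hV ⟨by decide, by decide⟩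
    have e2 : V refState ≤ V (step .controller true false t) := hV ⟨by decide, by decide⟩
    have e3 : V t ≤ V (step .sensor true true t) := hV ⟨by decide, by decide⟩
    have e4 : V refState ≤ V (step .sensor false true t) := hV ⟨by decide, by decide⟩
    have hfix_t := hfix t
    unfold bellman at hfix_t
    rcases min_choice (expNext ps pc .sensor V t) (expNext ps pc .controller V t) with h | h
    · rw [h] at hfix_t
      have f : (1 - ps) * V t + ps * V refState ≤ expNext ps pc .sensor V t := by
        have : 0 ≤ 1 - ps := by linarith
        simp only [expNext]
        gcongr
      have f' := mul_le_mul_of_nonneg_left f hα0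
      by_contra! hlt
      have g : b < ps * (V refState - V t) := by
        have : b / ps < V refState - V t := by linarith
        rwa [div_lt_iff₀' h1] at this
      have hd : 0 ≤ V refState - V t := by
        have : 0 ≤ b / ps := by positivity
        linarith
      have := mul_nonneg (mul_nonneg (sub_nonneg.2 hα1.le) (sub_nonneg.2 h2.le)) hd
      have := hc t.1.2
      nlinarith
    · rw [h] at hfix_t
      have f : V refState ≤ expNext ps pc .controller V t := by
        have : 0 ≤ 1 - pc := by linarith
        calc V refState = (1 - pc) * V refState + pc * V refState := by ring
          _ ≤ _ := by simp only [expNext]; gcongr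
      have f' := mul_le_mul_of_nonneg_left f hα0
      have := hc t.1.2
      linarith
  obtain ⟨⟨τ, φ⟩, hs⟩ := s
  have hs' := hs
  obtain ⟨hs1, hs2, hs3, hs4⟩ := hs
  simp only at hs1 hs2 hs3 hs4
  rcases hs1.eq_or_lt with rfl | hlt
  · refine key.trans ?_
    gcongr
    exact hV ⟨le_rfl, show 3 ≤ φ by omega⟩
  · have : V refState ≤ V ⟨(τ, φ), hs'⟩ := hV ⟨hlt, hs2⟩
    linarith

/-- The average-cost optimality equation has a solution `(J, h)` with `h` bounded below, and bounded
above by an affine function of the stage cost. It is obtained from relative discounted values in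
the limit of vanishing discount. -/
theorem exists_averageCost_solution (hc : ∀ φ, 0 ≤ c φ) (hmono : Monotone c) {r C : ℝ}
    (hps : ps ∈ Set.Ioo (0 : ℝ) 1) (hpc : pc ∈ Set.Ioo (0 : ℝ) 1)
    (hr : 1 < r) (hpsr : ps * r < 1) (hpcr : pc * r < 1)
    (hgrow : ∀ φ k, c (φ + k) ≤ C * r ^ k * (1 + c φ)) :
    ∃ (J D : ℝ) (h : stateSpace → ℝ), 0 ≤ J ∧ 0 ≤ D ∧ (∀ s, -D ≤ h s) ∧
      (∀ s, h s ≤ D * (1 + c s.1.2)) ∧ ∀ s, J + h s = bellman ps pc c 1 h s := by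
  obtain ⟨π, W, D, hD, hW0, hWD, hlyap⟩ := exists_lyapunov hc hmono hps hpc hr hpsr hpcr hgrow
  let β : ℕ → ℝ := fun k => 1 - 1 / ((k : ℝ) + 1)
  have hβ0 : ∀ k, 0 ≤ β k := fun k => by
    simp only [β, sub_nonneg]
    rw [div_le_one (by positivity)]
    linarith [(Nat.cast_nonneg k : (0 : ℝ) ≤ k)]
  have hβ1 : ∀ k, β k < 1 := fun k => sub_lt_self _ (by positivity)
  have hβ : Tendsto β (hyperfilter ℕ) (𝓝 1) := by
    have h : Tendsto β atTop (𝓝 (1 - 0)) := tendsto_one_div_add_atTop_nhds_zero_nat.const_sub 1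
    rw [sub_zero] at h
    exact h.mono_left (Nat.hyperfilter_le_atTop)
  choose V hV0 hVm hfix hVW hV1 using fun k =>
    exists_discounted_value hc hmono hps hpc hW0 hlyap (hβ0 k) (hβ1 k)
  have hlow := fun k => discounted_value_refState_le hc hps hpc (hβ0 k) (hβ1 k) (hVm k) (hV0 k)
    (hfix k) (hV1 k)
  -- Limits along an ultrafilter give convergence at all states simultaneously.
  have hlimit : ∀ (u : ℕ → ℝ) (x y : ℝ), (∀ k, u k ∈ Set.Icc x y) →
      ∃ l ∈ Set.Icc x y, Tendsto u (hyperfilter ℕ) (𝓝 l) := by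
    intro u x y hu
    obtain ⟨l, hl, hle⟩ := isCompact_Icc.ultrafilter_le_nhds ((hyperfilter ℕ).map u)
      (le_principal_iff.2 (Filter.mem_map.2 (univ_mem' hu)))
    exact ⟨l, hl, hle⟩
  obtain ⟨J, hJ, hJlim⟩ := hlimit (fun k => (1 - β k) * V k refState) 0 (W refState) fun k =>
    ⟨mul_nonneg (sub_nonneg.2 (hβ1 k).le) (hV0 k _), hV1 k⟩
  choose h hh hhlim using fun s => hlimit (fun k => V k s - V k refState) (-(W refState / ps)) (W s)
    fun k => ⟨by linarith [hlow k s], by linarith [hVW k s]⟩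
  refine ⟨J, max D (W refState / ps), h, hJ.1, hD.trans (le_max_left _ _), fun s => ?_, fun s => ?_,
    fun s => ?_⟩
  · linarith [(hh s).1, le_max_right D (W refState / ps)]
  · refine ((hh s).2.trans (hWD s)).trans ?_
    have := hc s.1.2
    gcongr
    exact le_max_left _ _
  · refine tendsto_nhds_unique (hJlim.add (hhlim s))
      ((tendsto_bellman hβ hhlim s).congr fun k => ?_)
    have e : ∀ a, expNext ps pc a (V k) s =
        expNext ps pc a (fun t => V k t - V k refState) s + V k refState := by
      intro a
      rw [← expNext_add_const]
      simp
    have hk := hfix k s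
    unfold bellman at hk ⊢
    rw [e, e, min_add_add_right] at hk
    linarith

end Bellman

/-! ### Independence and the law of the indicators -/

instance : Finite Action := Finite.of_injective (fun a => decide (a = .sensor)) fun a b h => by
  cases a <;> cases b <;> simp_all

instance : DiscreteMeasurableSpace Action := ⟨fun _ => trivial⟩

/-- The private randomness and the channels in the slots before `k`. -/
def Source.channelsBefore (k : ℕ) : Set Source :=
  {src | match src with
    | .privateRand => True
    | .uplink j => j < k
    | .downlink j => j < k
    | _ => False}

/-- The private randomness and the channels in all slots. -/
def Source.channels : Set Source :=
  {src | match src with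
    | .initial => False
    | .noise _ => False
    | _ => True}

/-- All sources except the plant disturbances from slot `k` on. -/
def Source.noiseBefore (k : ℕ) : Set Source :=
  {src | match src with
    | .noise j => j < k
    | _ => True}

namespace Environment

variable {Ω : Type*} [mΩ : MeasurableSpace Ω] {P : Measure Ω} {n m : ℕ}
  {A R : Matrix (Fin n) (Fin n) ℝ} {ps pc : ℝ}

/-- The σ-algebra generated by one of the sources of randomness. -/
@[reducible]
def sourceInfo (env : Environment P A R ps pc) (s : stateSpace) (src : Source) :
    MeasurableSpace Ω :=
  match src with
  | .initial => MeasurableSpace.comap (fun ω => (env.x₀ s ω, env.xhat₀ s ω)) inferInstance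
  | .privateRand => MeasurableSpace.comap env.ζ inferInstance
  | .noise k => MeasurableSpace.comap (env.w k) inferInstance
  | .uplink k => MeasurableSpace.comap (env.up k) inferInstance
  | .downlink k => MeasurableSpace.comap (env.dn k) inferInstance

/-- The σ-algebra generated by a set of sources of randomness. -/
@[reducible]
def sourcesInfo (env : Environment P A R ps pc) (s : stateSpace) (S : Set Source) :
    MeasurableSpace Ω :=
  ⨆ src ∈ S, env.sourceInfo s src

variable (env : Environment P A R ps pc) (s : stateSpace)

lemma sourceInfo_le (src : Source) : env.sourceInfo s src ≤ mΩ := by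
  cases src with
  | initial => exact ((env.measurable_x₀ s).prodMk (env.measurable_xhat₀ s)).comap_le
  | privateRand => exact env.measurable_ζ.comap_le
  | noise k => exact (env.measurable_w k).comap_le
  | uplink k => exact (env.measurable_up k).comap_le
  | downlink k => exact (env.measurable_dn k).comap_le

lemma sourcesInfo_le (S : Set Source) : env.sourcesInfo s S ≤ mΩ :=
  iSup₂_le fun src _ => env.sourceInfo_le s src

lemma sourcesInfo_mono {S T : Set Source} (h : S ⊆ T) :
    env.sourcesInfo s S ≤ env.sourcesInfo s T :=
  biSup_mono h

lemma sourceInfo_le_sourcesInfo {S : Set Source} {src : Source} (h : src ∈ S) :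
    env.sourceInfo s src ≤ env.sourcesInfo s S :=
  le_biSup (env.sourceInfo s) h

lemma indep_sourcesInfo {S T : Set Source} (h : Disjoint S T) :
    Indep (env.sourcesInfo s S) (env.sourcesInfo s T) P :=
  indep_iSup_of_disjoint (env.sourceInfo_le s) (env.indep s) h

lemma indep_sourceInfo {S : Set Source} {src : Source} (h : src ∉ S) :
    Indep (env.sourcesInfo s S) (env.sourceInfo s src) P :=
  indep_of_indep_of_le_right (env.indep_sourcesInfo s (Set.disjoint_singleton_right.2 h))
    (env.sourceInfo_le_sourcesInfo s rfl)

lemma measurable_up_sourcesInfo {S : Set Source} {k : ℕ} (h : .uplink k ∈ S) :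
    Measurable[env.sourcesInfo s S] (env.up k) :=
  measurable_iff_comap_le.2 (env.sourceInfo_le_sourcesInfo s h)

lemma measurable_dn_sourcesInfo {S : Set Source} {k : ℕ} (h : .downlink k ∈ S) :
    Measurable[env.sourcesInfo s S] (env.dn k) :=
  measurable_iff_comap_le.2 (env.sourceInfo_le_sourcesInfo s h)

lemma measurable_w_sourcesInfo {S : Set Source} {k : ℕ} (h : .noise k ∈ S) :
    Measurable[env.sourcesInfo s S] (env.w k) :=
  measurable_iff_comap_le.2 (env.sourceInfo_le_sourcesInfo s h)

lemma measurable_initial_sourcesInfo {S : Set Source} (h : .initial ∈ S) :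
    Measurable[env.sourcesInfo s S] fun ω => (env.x₀ s ω, env.xhat₀ s ω) :=
  measurable_iff_comap_le.2 (env.sourceInfo_le_sourcesInfo s h)

lemma channelsBefore_mono {j k : ℕ} (h : j ≤ k) :
    Source.channelsBefore j ⊆ Source.channelsBefore k := by
  rintro (_ | _ | _ | _ | _) hs <;>
    simp only [Source.channelsBefore, Set.mem_ofPred_eq] at hs ⊢ <;> omega

lemma channelsBefore_subset_channels (k : ℕ) : Source.channelsBefore k ⊆ Source.channels := by
  rintro (_ | _ | _ | _ | _) hs <;>
    simp only [Source.channelsBefore, Source.channels, Set.mem_ofPred_eq] at hs ⊢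

lemma channels_subset_noiseBefore (k : ℕ) : Source.channels ⊆ Source.noiseBefore k := by
  rintro (_ | _ | _ | _ | _) hs <;>
    simp only [Source.noiseBefore, Source.channels, Set.mem_ofPred_eq] at hs ⊢

lemma noiseBefore_mono {j k : ℕ} (h : j ≤ k) :
    Source.noiseBefore j ⊆ Source.noiseBefore k := by
  rintro (_ | _ | i | _ | _) hs
  case noise => exact lt_of_lt_of_le (show i < j from hs) h
  all_goals exact trivial

/-- Each action is a function of the private randomness and the channel states of earlier slots. -/
def Causal (a : ℕ → Ω → Action) : Prop :=
  ∀ k, Measurable[env.sourcesInfo s (Source.channelsBefore k)] (a k)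

/-- The indicators `(τ_k, φ_k)` under the scheduling sequence `a`, started at `s`. -/
def indicators (a : ℕ → Ω → Action) : ℕ → Ω → stateSpace
  | 0, _ => s
  | k + 1, ω => step (a k ω) (env.up k ω) (env.dn k ω) (indicators a k ω)

variable {a : ℕ → Ω → Action}

lemma measurable_delta {S : Set Source} {k : ℕ} (ha : Measurable[env.sourcesInfo s S] (a k))
    (hup : Measurable[env.sourcesInfo s S] (env.up k)) :
    Measurable[env.sourcesInfo s S] (env.delta a k) :=
  (Measurable.of_discrete (f := fun p : Action × Bool => decide (p.1 = .sensor) && p.2)).comp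
    (ha.prodMk hup)

lemma measurable_gamma {S : Set Source} {k : ℕ} (ha : Measurable[env.sourcesInfo s S] (a k))
    (hdn : Measurable[env.sourcesInfo s S] (env.dn k)) :
    Measurable[env.sourcesInfo s S] (env.gamma a k) :=
  (Measurable.of_discrete (f := fun p : Action × Bool => decide (p.1 = .controller) && p.2)).comp
    (ha.prodMk hdn)

variable {env s}

/-- Past transmission outcomes are functions of past actions and past channel states. -/
lemma Admissible.causal (ha : env.Admissible a) : env.Causal s a := by
  intro k
  induction k using Nat.strong_induction_on with
  | _ k ih =>
    refine (ha k).mono (sup_le ?_ (iSup_le fun j => ?_)) le_rfl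
    · exact env.sourceInfo_le_sourcesInfo s (src := .privateRand)
        (by simp [Source.channelsBefore])
    · have haj : Measurable[env.sourcesInfo s (Source.channelsBefore k)] (a j) :=
        (ih j j.2).mono (env.sourcesInfo_mono s (channelsBefore_mono j.2.le)) le_rfl
      have hup := env.measurable_up_sourcesInfo s (S := Source.channelsBefore k) (k := j)
        (by simp [Source.channelsBefore])
      have hdn := env.measurable_dn_sourcesInfo s (S := Source.channelsBefore k) (k := j)
        (by simp [Source.channelsBefore])
      exact (haj.prodMk ((env.measurable_delta s haj hup).prodMk
        (env.measurable_gamma s haj hdn))).comap_le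

lemma measurable_step {S : Set Source} {k : ℕ} {b : Ω → Action} {t : Ω → stateSpace}
    (hb : Measurable[env.sourcesInfo s S] b) (ht : Measurable[env.sourcesInfo s S] t)
    (hup : Measurable[env.sourcesInfo s S] (env.up k))
    (hdn : Measurable[env.sourcesInfo s S] (env.dn k)) :
    Measurable[env.sourcesInfo s S] fun ω => step (b ω) (env.up k ω) (env.dn k ω) (t ω) :=
  (Measurable.of_discrete
    (f := fun p : Action × Bool × Bool × stateSpace => step p.1 p.2.1 p.2.2.1 p.2.2.2)).comp
    (hb.prodMk (hup.prodMk (hdn.prodMk ht)))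

lemma Causal.measurable_indicators (ha : env.Causal s a) (k : ℕ) :
    Measurable[env.sourcesInfo s (Source.channelsBefore k)] (env.indicators s a k) := by
  induction k with
  | zero => exact measurable_const
  | succ k ih =>
    have hle := env.sourcesInfo_mono s (channelsBefore_mono (Nat.le_succ k))
    exact measurable_step ((ha k).mono hle le_rfl) (ih.mono hle le_rfl)
      (env.measurable_up_sourcesInfo s (by simp [Source.channelsBefore]))
      (env.measurable_dn_sourcesInfo s (by simp [Source.channelsBefore]))

variable (env s) in
lemma causal_policyActions (π : StationaryPolicy) : env.Causal s (env.policyActions π s) := by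
  have h : ∀ k, Measurable[env.sourcesInfo s (Source.channelsBefore k)]
      (env.policyState π s k) := by
    intro k
    induction k with
    | zero => exact measurable_const
    | succ k ih =>
      have ih' := ih.mono (env.sourcesInfo_mono s (channelsBefore_mono (Nat.le_succ k))) le_rfl
      exact measurable_step ((Measurable.of_discrete (f := π)).comp ih') ih'
        (env.measurable_up_sourcesInfo s (by simp [Source.channelsBefore]))
        (env.measurable_dn_sourcesInfo s (by simp [Source.channelsBefore]))
  exact fun k => (Measurable.of_discrete (f := π)).comp (h k)

variable (env s) in
lemma indicators_policyActions (π : StationaryPolicy) (k : ℕ) :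
    env.indicators s (env.policyActions π s) k = env.policyState π s k := by
  induction k with
  | zero => rfl
  | succ k ih =>
    funext ω
    simp only [indicators, policyState, ih]
    rfl

variable (env) in
lemma prob_up_true [IsProbabilityMeasure P] (hps : ps ∈ Set.Ioo (0 : ℝ) 1) (k : ℕ) :
    P {ω | env.up k ω = true} = ENNReal.ofReal (1 - ps) := by
  have h : {ω | env.up k ω = true} = {ω | env.up k ω = false}ᶜ := by ext; simp
  have hm : MeasurableSet {ω | env.up k ω = false} :=
    env.measurable_up k (measurableSet_singleton false)
  rw [h, prob_compl_eq_one_sub hm, env.prob_up, ENNReal.ofReal_sub _ hps.1.le, ENNReal.ofReal_one]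

variable (env) in
lemma prob_dn_true [IsProbabilityMeasure P] (hpc : pc ∈ Set.Ioo (0 : ℝ) 1) (k : ℕ) :
    P {ω | env.dn k ω = true} = ENNReal.ofReal (1 - pc) := by
  have h : {ω | env.dn k ω = true} = {ω | env.dn k ω = false}ᶜ := by ext; simp
  have hm : MeasurableSet {ω | env.dn k ω = false} :=
    env.measurable_dn k (measurableSet_singleton false)
  rw [h, prob_compl_eq_one_sub hm, env.prob_dn, ENNReal.ofReal_sub _ hpc.1.le, ENNReal.ofReal_one]

/-- The channels of slot `k` are independent of the past, so the indicators move according to the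
transition probabilities that `expNext` encodes. -/
lemma Causal.lintegral_indicators_succ [IsProbabilityMeasure P] (ha : env.Causal s a)
    (hps : ps ∈ Set.Ioo (0 : ℝ) 1) (hpc : pc ∈ Set.Ioo (0 : ℝ) 1)
    {V : stateSpace → ℝ} (hV : ∀ t, 0 ≤ V t) (k : ℕ) :
    ∫⁻ ω, ENNReal.ofReal (V (env.indicators s a (k + 1) ω)) ∂P =
      ∫⁻ ω, ENNReal.ofReal (expNext ps pc (a k ω) V (env.indicators s a k ω)) ∂P := by
  have hle := env.sourcesInfo_le s (Source.channelsBefore k)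
  -- `G b t` is the value of the successor `t` on the event that action `b` is taken.
  let G : Action → (stateSpace → stateSpace) → Ω → ℝ≥0∞ := fun b t ω =>
    if a k ω = b then ENNReal.ofReal (V (t (env.indicators s a k ω))) else 0
  have hG : ∀ b t, Measurable[env.sourcesInfo s (Source.channelsBefore k)] (G b t) := fun b t =>
    (Measurable.of_discrete (f := fun p : Action × stateSpace =>
      if p.1 = b then ENNReal.ofReal (V (t p.2)) else 0)).comp
      ((ha k).prodMk (ha.measurable_indicators k))
  have hup : ∀ b t c, ∫⁻ ω, G b t ω * {ω | env.up k ω = c}.indicator (fun _ => 1) ω ∂P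
      = (∫⁻ ω, G b t ω ∂P) * P {ω | env.up k ω = c} := by
    intro b t c
    have hc : MeasurableSet[env.sourceInfo s (.uplink k)] {ω | env.up k ω = c} :=
      ⟨{c}, measurableSet_singleton c, rfl⟩
    rw [lintegral_mul_eq_lintegral_mul_lintegral_of_independent_measurableSpace hle
      (env.sourceInfo_le s _) (env.indep_sourceInfo s (src := .uplink k)
        (by simp [Source.channelsBefore])) (hG b t) (measurable_const.indicator hc),
      lintegral_indicator (env.sourceInfo_le s _ _ hc)]
    simp
  have hdn : ∀ b t c, ∫⁻ ω, G b t ω * {ω | env.dn k ω = c}.indicator (fun _ => 1) ω ∂P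
      = (∫⁻ ω, G b t ω ∂P) * P {ω | env.dn k ω = c} := by
    intro b t c
    have hc : MeasurableSet[env.sourceInfo s (.downlink k)] {ω | env.dn k ω = c} :=
      ⟨{c}, measurableSet_singleton c, rfl⟩
    rw [lintegral_mul_eq_lintegral_mul_lintegral_of_independent_measurableSpace hle
      (env.sourceInfo_le s _) (env.indep_sourceInfo s (src := .downlink k)
        (by simp [Source.channelsBefore])) (hG b t) (measurable_const.indicator hc),
      lintegral_indicator (env.sourceInfo_le s _ _ hc)]
    simp
  have hG' : ∀ b t, Measurable (G b t) := fun b t => (hG b t).mono hle le_rfl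
  have hupm : ∀ b t c, Measurable fun ω =>
      G b t ω * {ω | env.up k ω = c}.indicator (fun _ => (1 : ℝ≥0∞)) ω := fun b t c =>
    (hG' b t).mul (measurable_const.indicator (env.measurable_up k (measurableSet_singleton c)))
  have hdnm : ∀ b t c, Measurable fun ω =>
      G b t ω * {ω | env.dn k ω = c}.indicator (fun _ => (1 : ℝ≥0∞)) ω := fun b t c =>
    (hG' b t).mul (measurable_const.indicator (env.measurable_dn k (measurableSet_singleton c)))
  calc ∫⁻ ω, ENNReal.ofReal (V (env.indicators s a (k + 1) ω)) ∂P
      = ∫⁻ ω, (G .sensor (step .sensor true true) ω *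
            {ω | env.up k ω = true}.indicator (fun _ => 1) ω +
          (G .sensor (step .sensor false true) ω *
            {ω | env.up k ω = false}.indicator (fun _ => 1) ω +
          (G .controller (step .controller true true) ω *
            {ω | env.dn k ω = true}.indicator (fun _ => 1) ω +
          G .controller (step .controller true false) ω *
            {ω | env.dn k ω = false}.indicator (fun _ => 1) ω))) ∂P := by
        refine lintegral_congr fun ω => ?_
        have h1 : ∀ u d t, step .sensor u d t = step .sensor u true t := fun u d t =>
          Subtype.ext (by simp [step])
        have h2 : ∀ u d t, step .controller u d t = step .controller true d t := fun u d t =>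
          Subtype.ext (by simp [step])
        simp only [indicators, G]
        rcases a k ω with _ | _
        · rw [h1]; cases hu : env.up k ω <;> simp [Set.indicator, hu]
        · rw [h2]; cases hd : env.dn k ω <;> simp [Set.indicator, hd]
    _ = ∫⁻ ω, (G .sensor (step .sensor true true) ω * ENNReal.ofReal (1 - ps) +
          (G .sensor (step .sensor false true) ω * ENNReal.ofReal ps +
          (G .controller (step .controller true true) ω * ENNReal.ofReal (1 - pc) +
          G .controller (step .controller true false) ω * ENNReal.ofReal pc))) ∂P := by
        rw [lintegral_add_left (hupm _ _ _), lintegral_add_left (hupm _ _ _),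
          lintegral_add_left (hdnm _ _ _), hup, hup, hdn, hdn, env.prob_up_true hps,
          env.prob_up, env.prob_dn_true hpc, env.prob_dn,
          lintegral_add_left ((hG' _ _).mul_const _), lintegral_add_left ((hG' _ _).mul_const _),
          lintegral_add_left ((hG' _ _).mul_const _)]
        simp only [lintegral_mul_const _ (hG' _ _)]
    _ = _ := by
        refine lintegral_congr fun ω => ?_
        have h1 := hps.1.le
        have h2 : 0 ≤ 1 - ps := by linarith [hps.2]
        have h3 := hpc.1.le
        have h4 : 0 ≤ 1 - pc := by linarith [hpc.2]
        simp only [G]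
        rcases a k ω with _ | _
        · simp [expNext, ENNReal.ofReal_add (mul_nonneg h2 (hV _)) (mul_nonneg h1 (hV _)),
            ENNReal.ofReal_mul h1, ENNReal.ofReal_mul h2, mul_comm]
        · simp [expNext, ENNReal.ofReal_add (mul_nonneg h4 (hV _)) (mul_nonneg h3 (hV _)),
            ENNReal.ofReal_mul h3, ENNReal.ofReal_mul h4, mul_comm]

end Environment

/-! ### Second moments of the control loop -/

section Covariance

variable {n : ℕ}

lemma covF_zero (A R : Matrix (Fin n) (Fin n) ℝ) : covF A R 0 = 0 := by simp [covF]

lemma covF_one (A R : Matrix (Fin n) (Fin n) ℝ) : covF A R 1 = R := by simp [covF]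

lemma covF_succ (A R : Matrix (Fin n) (Fin n) ℝ) (τ : ℕ) :
    covF A R (τ + 1) = A * covF A R τ * Aᵀ + R := by
  rw [covF, Finset.sum_range_succ', covF, Finset.mul_sum, Finset.sum_mul]
  congr 1
  · refine Finset.sum_congr rfl fun i _ => ?_
    rw [pow_succ' A, pow_succ Aᵀ]
    simp only [Matrix.mul_assoc]
  · simp

lemma covF_quadForm_succ (A R : Matrix (Fin n) (Fin n) ℝ) (τ : ℕ) (v : Fin n → ℝ) :
    v ⬝ᵥ covF A R (τ + 1) *ᵥ v =
      (v ᵥ* A) ⬝ᵥ covF A R τ *ᵥ (v ᵥ* A) + v ⬝ᵥ covF A R 1 *ᵥ v := by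
  rw [covF_succ, covF_one, Matrix.add_mulVec, dotProduct_add, ← Matrix.mulVec_mulVec,
    ← Matrix.mulVec_mulVec, Matrix.mulVec_transpose, Matrix.dotProduct_mulVec v A]

lemma covF_quadForm_nonneg (A : Matrix (Fin n) (Fin n) ℝ) {R : Matrix (Fin n) (Fin n) ℝ}
    (hR : R.PosSemidef) (τ : ℕ) (v : Fin n → ℝ) : 0 ≤ v ⬝ᵥ covF A R τ *ᵥ v := by
  induction τ generalizing v with
  | zero => simp [covF_zero]
  | succ τ ih =>
    rw [covF_quadForm_succ, covF_one]
    exact add_nonneg (ih _) (by simpa using hR.dotProduct_mulVec_nonneg v)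

lemma dotProduct_sq_eq_sum (v y : Fin n → ℝ) :
    (v ⬝ᵥ y) ^ 2 = ∑ i, ∑ j, v i * v j * (y i * y j) := by
  rw [pow_two, dotProduct, Finset.sum_mul_sum]
  exact Finset.sum_congr rfl fun i _ => Finset.sum_congr rfl fun j _ => by ring

lemma quadForm_eq_sum (M : Matrix (Fin n) (Fin n) ℝ) (v : Fin n → ℝ) :
    v ⬝ᵥ M *ᵥ v = ∑ i, ∑ j, v i * v j * M i j := by
  simp only [dotProduct, Matrix.mulVec, Finset.mul_sum]
  exact Finset.sum_congr rfl fun i _ => Finset.sum_congr rfl fun j _ => by ring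

lemma memLp_dotProduct {Ω : Type*} [MeasurableSpace Ω] {P : Measure Ω} {y : Ω → Fin n → ℝ}
    (hy : ∀ i, MemLp (fun ω => y ω i) 2 P) (v : Fin n → ℝ) :
    MemLp (fun ω => v ⬝ᵥ y ω) 2 P :=
  memLp_finsetSum _ fun i _ => (hy i).const_mul (v i)

end Covariance

namespace Environment

variable {Ω : Type*} [mΩ : MeasurableSpace Ω] {P : Measure Ω} {n m : ℕ}
  {A R : Matrix (Fin n) (Fin n) ℝ} {ps pc : ℝ}

/-- The random vector `y` is square integrable and, conditionally on the channels and the private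
randomness, its matrix of second moments is `F(τ)`. The conditional statement is spelt out as
equality of the integrals over every event of the conditioning σ-algebra. -/
structure HasAge (env : Environment P A R ps pc) (s : stateSpace) (y : Ω → Fin n → ℝ) (τ : Ω → ℕ) :
    Prop where
  memLp : ∀ i, MemLp (fun ω => y ω i) 2 P
  lintegral_sq : ∀ (v : Fin n → ℝ) (D : Set Ω),
    MeasurableSet[env.sourcesInfo s Source.channels] D →
      ∫⁻ ω in D, ENNReal.ofReal ((v ⬝ᵥ y ω) ^ 2) ∂P =
        ∫⁻ ω in D, ENNReal.ofReal (v ⬝ᵥ covF A R (τ ω) *ᵥ v) ∂P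

variable {env : Environment P A R ps pc} {s : stateSpace}

/-- The zero vector has age zero, since `F(0) = 0`. -/
lemma hasAge_zero : env.HasAge s (fun _ => 0) fun _ => 0 :=
  ⟨fun _ => MemLp.zero', fun v D _ => by simp [covF_zero]⟩

/-- A random vector which is independent of the channels and has second moments `F(τ)` has the
deterministic age `τ`. -/
lemma hasAge_of_indep [IsProbabilityMeasure P] {y : Ω → Fin n → ℝ} {τ : ℕ} (hy : Measurable y)
    (hmem : ∀ i, MemLp (fun ω => y ω i) 2 P)
    (hind : Indep (env.sourcesInfo s Source.channels) (MeasurableSpace.comap y inferInstance) P)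
    (hcov : ∀ i j, ∫ ω, y ω i * y ω j ∂P = covF A R τ i j) :
    env.HasAge s y fun _ => τ := by
  refine ⟨hmem, fun v D hD => ?_⟩
  have hsq : Measurable fun x : Fin n → ℝ => ENNReal.ofReal ((v ⬝ᵥ x) ^ 2) := by
    unfold dotProduct
    fun_prop
  have hint : ∫⁻ ω, ENNReal.ofReal ((v ⬝ᵥ y ω) ^ 2) ∂P
      = ENNReal.ofReal (v ⬝ᵥ covF A R τ *ᵥ v) := by
    rw [← ofReal_integral_eq_lintegral_ofReal (memLp_dotProduct hmem v).integrable_sq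
      (Eventually.of_forall fun _ => sq_nonneg _), quadForm_eq_sum]
    simp only [dotProduct_sq_eq_sum]
    have hij : ∀ i j, Integrable (fun ω => v i * v j * (y ω i * y ω j)) P := fun i j =>
      ((hmem i).integrable_mul (hmem j)).const_mul _
    rw [integral_finsetSum _ fun i _ => integrable_finsetSum _ fun j _ => hij i j]
    congr 1
    refine Finset.sum_congr rfl fun i _ => ?_
    rw [integral_finsetSum _ fun j _ => hij i j]
    exact Finset.sum_congr rfl fun j _ => by rw [integral_const_mul, hcov]
  have hDm := env.sourcesInfo_le s _ D hD
  have h := lintegral_mul_eq_lintegral_mul_lintegral_of_independent_measurableSpace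
    (env.sourcesInfo_le s _) hy.comap_le hind
    (f := D.indicator fun _ => 1) (g := fun ω => ENNReal.ofReal ((v ⬝ᵥ y ω) ^ 2))
    (measurable_const.indicator hD) (hsq.comp (comap_measurable y))
  rw [lintegral_indicator_const hDm, hint] at h
  rw [← lintegral_indicator hDm, setLIntegral_const, mul_comm (ENNReal.ofReal _), ← one_mul (P D),
    ← h]
  refine lintegral_congr fun ω => ?_
  by_cases hω : ω ∈ D <;> simp [hω]

/-- A choice that depends only on the channels and the private randomness passes to the ages. -/
lemma HasAge.ite {y y' : Ω → Fin n → ℝ} {τ τ' : Ω → ℕ} (h : env.HasAge s y τ)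
    (h' : env.HasAge s y' τ') {b : Ω → Bool}
    (hb : Measurable[env.sourcesInfo s Source.channels] b) :
    env.HasAge s (fun ω => if b ω = true then y ω else y' ω)
      fun ω => if b ω = true then τ ω else τ' ω := by
  classical
  have hB : MeasurableSet[env.sourcesInfo s Source.channels] {ω | b ω = true} :=
    hb (measurableSet_singleton true)
  have hBm := env.sourcesInfo_le s _ _ hB
  refine ⟨fun i => ?_, fun v D hD => ?_⟩
  · have := MemLp.piecewise hBm ((h.memLp i).restrict _) ((h'.memLp i).restrict _)
    refine this.ae_eq (Eventually.of_forall fun ω => ?_)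
    by_cases hω : b ω = true <;> simp [Set.piecewise, hω]
  · have hDm := env.sourcesInfo_le s _ _ hD
    rw [← lintegral_inter_add_sdiff _ D hBm,
      ← lintegral_inter_add_sdiff (B := {ω | b ω = true}) _ D hBm]
    congr 1
    · have e := h.lintegral_sq v _ (hD.inter hB)
      rw [setLIntegral_congr_fun (hDm.inter hBm) fun ω hω => by
          rw [if_pos (show b ω = true from hω.2)], e]
      exact setLIntegral_congr_fun (hDm.inter hBm) fun ω hω => by
          rw [if_pos (show b ω = true from hω.2)]
    · have e := h'.lintegral_sq v _ (hD.diff hB)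
      rw [setLIntegral_congr_fun (hDm.diff hBm) fun ω hω => by
          rw [if_neg (show ¬ b ω = true from hω.2)], e]
      exact setLIntegral_congr_fun (hDm.diff hBm) fun ω hω => by
          rw [if_neg (show ¬ b ω = true from hω.2)]

lemma memLp_w (k : ℕ) (i : Fin n) : MemLp (fun ω => env.w k ω i) 2 P := by
  have hm : Measurable fun ω => WithLp.toLp 2 (env.w k ω) :=
    (WithLp.measurable_toLp 2 _).comp (env.measurable_w k)
  have h : MemLp (fun x : EuclideanSpace ℝ (Fin n) => x i) 2 (multivariateGaussian 0 R) :=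
    (EuclideanSpace.proj (𝕜 := ℝ) i).comp_memLp' IsGaussian.memLp_two_id
  rw [← env.law_w k] at h
  exact h.comp_of_map hm.aemeasurable

lemma integral_w (k : ℕ) (i : Fin n) : ∫ ω, env.w k ω i ∂P = 0 := by
  have hm : Measurable fun ω => WithLp.toLp 2 (env.w k ω) :=
    (WithLp.measurable_toLp 2 _).comp (env.measurable_w k)
  have h := (EuclideanSpace.proj (𝕜 := ℝ) i).integral_comp_id_comm
    (IsGaussian.integrable_id (μ := multivariateGaussian 0 R))
  rw [integral_id_multivariateGaussian, map_zero, ← env.law_w k,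
    integral_map hm.aemeasurable (by fun_prop)] at h
  exact h

lemma integral_w_mul (hR : R.PosSemidef) (k : ℕ) (i j : Fin n) :
    ∫ ω, env.w k ω i * env.w k ω j ∂P = R i j := by
  have hm : Measurable fun ω => WithLp.toLp 2 (env.w k ω) :=
    (WithLp.measurable_toLp 2 _).comp (env.measurable_w k)
  have hc := covariance_eval_multivariateGaussian (μ := 0) hR i j
  rw [← env.law_w k, covariance_map (by fun_prop) (by fun_prop) hm.aemeasurable] at hc
  rw [← hc, covariance]
  have h0 : ∀ i, ∫ ω, ((fun x : EuclideanSpace ℝ (Fin n) => x i) ∘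
      fun ω => WithLp.toLp 2 (env.w k ω)) ω ∂P = 0 := fun i => env.integral_w k i
  simp only [h0, sub_zero]
  rfl

/-- The fresh disturbance is centred and independent of the past, so that passing through the plant
and adding the disturbance increases the age by one. -/
lemma HasAge.next [IsProbabilityMeasure P] (hR : R.PosSemidef) {y : Ω → Fin n → ℝ} {τ : Ω → ℕ}
    {k : ℕ} (h : env.HasAge s y τ)
    (hy : Measurable[env.sourcesInfo s (Source.noiseBefore k)] y) :
    env.HasAge s (fun ω => A *ᵥ y ω + env.w k ω) fun ω => τ ω + 1 := by
  have hw : env.HasAge s (env.w k) fun _ => 1 :=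
    hasAge_of_indep (env.measurable_w k) (memLp_w k)
      (env.indep_sourceInfo s (src := .noise k) (by simp [Source.channels]))
      (by simpa [covF_one] using integral_w_mul hR k)
  refine ⟨fun i => (memLp_dotProduct h.memLp (A i)).add (memLp_w k i), fun v D hD => ?_⟩
  have hDm := env.sourcesInfo_le s _ _ hD
  set α : Ω → ℝ := fun ω => (v ᵥ* A) ⬝ᵥ y ω
  set β : Ω → ℝ := fun ω => v ⬝ᵥ env.w k ω with hβ
  have hαL : MemLp α 2 P := memLp_dotProduct h.memLp _
  have hβL : MemLp β 2 P := memLp_dotProduct (memLp_w k) _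
  have hβ0 : ∫ ω, β ω ∂P = 0 := by
    simp only [hβ, dotProduct]
    rw [integral_finsetSum _ fun i _ => ((memLp_w k i).integrable one_le_two).const_mul _]
    simp [integral_const_mul, integral_w]
  have hcross : ∫ ω in D, α ω * β ω ∂P = 0 := by
    have hαm : Measurable[env.sourcesInfo s (Source.noiseBefore k)] (D.indicator α) := by
      have : Measurable fun x : Fin n → ℝ => (v ᵥ* A) ⬝ᵥ x := by
        unfold dotProduct
        fun_prop
      exact (this.comp hy).indicator
        (env.sourcesInfo_mono s (channels_subset_noiseBefore k) _ hD)
    have hβm : Measurable[env.sourceInfo s (.noise k)] β := by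
      have : Measurable fun x : Fin n → ℝ => v ⬝ᵥ x := by
        unfold dotProduct
        fun_prop
      exact this.comp (comap_measurable _)
    have hind : IndepFun (D.indicator α) β P :=
      (IndepFun_iff_Indep _ _ _).2 (indep_of_indep_of_le_left (indep_of_indep_of_le_right
        (env.indep_sourceInfo s (src := .noise k) (S := Source.noiseBefore k)
          (by simp [Source.noiseBefore])) hβm.comap_le) hαm.comap_le)
    have hmul := hind.integral_fun_mul_eq_mul_integral
      (hαm.mono (env.sourcesInfo_le s _) le_rfl).aestronglyMeasurable
      hβL.aestronglyMeasurable
    rw [hβ0, mul_zero] at hmul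
    rw [← integral_indicator hDm, ← hmul]
    refine integral_congr_ae (Eventually.of_forall fun ω => ?_)
    by_cases hω : ω ∈ D <;> simp [hω]
  have hα2 := (hαL.integrable_sq).restrict (s := D)
  have hβ2 := (hβL.integrable_sq).restrict (s := D)
  have hαβ : Integrable (fun ω => 2 * (α ω * β ω)) (P.restrict D) :=
    ((hαL.integrable_mul hβL).restrict (s := D)).const_mul 2
  have hαα : Integrable (fun ω => α ω ^ 2 + 2 * (α ω * β ω)) (P.restrict D) := hα2.add hαβ
  have hall : Integrable (fun ω => α ω ^ 2 + 2 * (α ω * β ω) + β ω ^ 2) (P.restrict D) :=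
    hαα.add hβ2
  have hsum : ∀ ω, (v ⬝ᵥ (A *ᵥ y ω + env.w k ω)) ^ 2 = α ω ^ 2 + 2 * (α ω * β ω) + β ω ^ 2 := by
    intro ω
    rw [dotProduct_add, Matrix.dotProduct_mulVec]
    ring
  calc ∫⁻ ω in D, ENNReal.ofReal ((v ⬝ᵥ (A *ᵥ y ω + env.w k ω)) ^ 2) ∂P
      = ENNReal.ofReal (∫ ω in D, α ω ^ 2 + 2 * (α ω * β ω) + β ω ^ 2 ∂P) := by
        rw [ofReal_integral_eq_lintegral_ofReal hall
          (Eventually.of_forall fun ω => (sq_nonneg _).trans_eq (hsum ω))]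
        simp only [hsum]
    _ = ENNReal.ofReal ((∫ ω in D, α ω ^ 2 ∂P) + ∫ ω in D, β ω ^ 2 ∂P) := by
        rw [integral_add hαα hβ2, integral_add hα2 hαβ,
          integral_const_mul, hcross, mul_zero, add_zero]
    _ = ∫⁻ ω in D, ENNReal.ofReal (α ω ^ 2) ∂P + ∫⁻ ω in D, ENNReal.ofReal (β ω ^ 2) ∂P := by
        rw [ENNReal.ofReal_add (integral_nonneg fun _ => sq_nonneg _)
          (integral_nonneg fun _ => sq_nonneg _),
          ofReal_integral_eq_lintegral_ofReal hα2 (Eventually.of_forall fun _ => sq_nonneg _),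
          ofReal_integral_eq_lintegral_ofReal hβ2 (Eventually.of_forall fun _ => sq_nonneg _)]
    _ = ∫⁻ ω in D, ENNReal.ofReal (v ⬝ᵥ covF A R (τ ω + 1) *ᵥ v) ∂P := by
        rw [h.lintegral_sq _ D hD, hw.lintegral_sq _ D hD,
          ← lintegral_add_right _ measurable_const]
        refine lintegral_congr fun ω => ?_
        rw [covF_quadForm_succ A R (τ ω),
          ENNReal.ofReal_add (covF_quadForm_nonneg A hR _ _) (covF_quadForm_nonneg A hR _ _)]

variable {B : Matrix (Fin n) (Fin m) ℝ} {K : Matrix (Fin m) (Fin n) ℝ} {a : ℕ → Ω → Action}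

variable (env s) in
/-- The estimation error `x_k - x̂_k`. -/
def estError (B : Matrix (Fin n) (Fin m) ℝ) (K : Matrix (Fin m) (Fin n) ℝ) (a : ℕ → Ω → Action)
    (k : ℕ) (ω : Ω) : Fin n → ℝ :=
  (env.loop B K a s k ω).1 - (env.loop B K a s k ω).2

/-- As `BK = -A`, a received command replaces the plant state by the estimation error. -/
lemma loop_succ_fst (hK : A + B * K = 0) (k : ℕ) (ω : Ω) :
    (env.loop B K a s (k + 1) ω).1 = A *ᵥ (if env.gamma a k ω = true then env.estError s B K a k ω
      else (env.loop B K a s k ω).1) + env.w k ω := by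
  have hBK : B * K = -A := by rw [eq_neg_iff_add_eq_zero, add_comm, hK]
  by_cases h : env.gamma a k ω = true
  · simp only [loop, h, if_true, estError, Matrix.mulVec_sub, Matrix.mulVec_mulVec, hBK,
      Matrix.neg_mulVec]
    abel
  · simp only [loop, h, if_false, Matrix.mulVec_zero, add_zero, Bool.false_eq_true]

/-- A received measurement resets the estimation error. -/
lemma estError_succ (k : ℕ) (ω : Ω) :
    env.estError s B K a (k + 1) ω = A *ᵥ (if env.delta a k ω = true then 0
      else env.estError s B K a k ω) + env.w k ω := by
  by_cases h : env.delta a k ω = true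
  · simp only [loop, h, if_true, estError, Matrix.mulVec_zero]
    abel
  · simp only [loop, h, if_false, estError, Matrix.mulVec_sub, Bool.false_eq_true]
    abel

lemma Causal.measurable_delta_channels (ha : env.Causal s a) (k : ℕ) :
    Measurable[env.sourcesInfo s Source.channels] (env.delta a k) :=
  env.measurable_delta s
    ((ha k).mono (env.sourcesInfo_mono s (channelsBefore_subset_channels k)) le_rfl)
    (env.measurable_up_sourcesInfo s (by simp [Source.channels]))

lemma Causal.measurable_gamma_channels (ha : env.Causal s a) (k : ℕ) :
    Measurable[env.sourcesInfo s Source.channels] (env.gamma a k) :=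
  env.measurable_gamma s
    ((ha k).mono (env.sourcesInfo_mono s (channelsBefore_subset_channels k)) le_rfl)
    (env.measurable_dn_sourcesInfo s (by simp [Source.channels]))

lemma Causal.measurable_loop (ha : env.Causal s a) (hK : A + B * K = 0) (k : ℕ) :
    Measurable[env.sourcesInfo s (Source.noiseBefore k)] (fun ω => (env.loop B K a s k ω).1) ∧
      Measurable[env.sourcesInfo s (Source.noiseBefore k)] (env.estError s B K a k) := by
  have hA : Measurable fun x : Fin n → ℝ => A *ᵥ x :=
    (continuous_const.matrix_mulVec continuous_id).measurable
  induction k with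
  | zero =>
    have h := env.measurable_initial_sourcesInfo s (S := Source.noiseBefore 0)
      (by simp [Source.noiseBefore])
    exact ⟨h.fst, h.fst.sub h.snd⟩
  | succ k ih =>
    have hle := env.sourcesInfo_mono s (noiseBefore_mono (Nat.le_succ k))
    have hchan := env.sourcesInfo_mono s (channels_subset_noiseBefore (k + 1))
    have hx := ih.1.mono hle le_rfl
    have he := ih.2.mono hle le_rfl
    have hw := env.measurable_w_sourcesInfo s (S := Source.noiseBefore (k + 1)) (k := k)
      (by simp [Source.noiseBefore])
    simp only [loop_succ_fst hK, funext (estError_succ (env := env) (s := s) (B := B) (K := K)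
      (a := a) k)]
    constructor
    · refine (hA.comp (Measurable.ite ?_ he hx)).add hw
      exact hchan _ (ha.measurable_gamma_channels k (measurableSet_singleton true))
    · refine (hA.comp (Measurable.ite ?_ measurable_const he)).add hw
      exact hchan _ (ha.measurable_delta_channels k (measurableSet_singleton true))

/-- The indicators are the ages of the plant state and of the estimation error. -/
lemma Causal.hasAge [IsProbabilityMeasure P] (ha : env.Causal s a) (hK : A + B * K = 0)
    (hR : R.PosSemidef) (k : ℕ) :
    env.HasAge s (fun ω => (env.loop B K a s k ω).1) (fun ω => (env.indicators s a k ω).1.2) ∧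
      env.HasAge s (env.estError s B K a k) (fun ω => (env.indicators s a k ω).1.1) := by
  induction k with
  | zero =>
    have hind := env.indep_sourceInfo s (src := .initial) (S := Source.channels)
      (by simp [Source.channels])
    have h0 : Measurable[env.sourceInfo s .initial] fun ω => (env.x₀ s ω, env.xhat₀ s ω) :=
      comap_measurable _
    constructor
    · exact hasAge_of_indep (env.measurable_x₀ s) (env.memLp_x₀ s)
        (indep_of_indep_of_le_right hind h0.fst.comap_le) (env.cov_x₀ s)
    · exact hasAge_of_indep (env.measurable_x₀ s |>.sub (env.measurable_xhat₀ s))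
        (fun i => (env.memLp_x₀ s i).sub (env.memLp_xhat₀ s i))
        (indep_of_indep_of_le_right hind (h0.fst.sub h0.snd).comap_le) (env.cov_err₀ s)
  | succ k ih =>
    have hm := ha.measurable_loop hK k
    have hchan := env.sourcesInfo_mono s (channels_subset_noiseBefore k)
    have hγ := ha.measurable_gamma_channels k
    have hδ := ha.measurable_delta_channels k
    have hx := (ih.2.ite ih.1 hγ).next hR
      (Measurable.ite (hchan _ (hγ (measurableSet_singleton true))) hm.2 hm.1)
    have he := ((hasAge_zero (env := env) (s := s)).ite ih.2 hδ).next hR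
      (Measurable.ite (hchan _ (hδ (measurableSet_singleton true))) measurable_const hm.2)
    simp only [loop_succ_fst hK, funext (estError_succ (env := env) (s := s) (B := B) (K := K)
      (a := a) k)]
    constructor
    · convert hx using 2 with ω
      simp only [indicators, step, gamma]
      split_ifs <;> simp_all
    · convert he using 2 with ω
      simp only [indicators, step, delta]
      split_ifs <;> simp_all

/-- The expected stage cost of the control loop is that of the indicators. -/
lemma Causal.lintegral_cost [IsProbabilityMeasure P] {Q : Matrix (Fin n) (Fin n) ℝ}
    (ha : env.Causal s a) (hK : A + B * K = 0) (hQ : Q.PosDef) (hR : R.PosDef) (k : ℕ) :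
    ∫⁻ ω, ENNReal.ofReal
        ((env.loop B K a s k ω).1 ⬝ᵥ Q *ᵥ (env.loop B K a s k ω).1) ∂P =
      ∫⁻ ω, ENNReal.ofReal (stageCost A Q R (env.indicators s a k ω).1.2) ∂P := by
  obtain ⟨S, -, rfl⟩ := exists_isUnit_transpose_mul_self hQ
  have hage := (ha.hasAge (B := B) (K := K) hK hR.posSemidef k).1
  have hquad : ∀ x : Fin n → ℝ, x ⬝ᵥ (Sᵀ * S) *ᵥ x = ∑ i, (S i ⬝ᵥ x) ^ 2 := by
    intro x
    rw [← Matrix.mulVec_mulVec, Matrix.dotProduct_mulVec, Matrix.vecMul_transpose]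
    simp [dotProduct, Matrix.mulVec, pow_two]
  have htrace : ∀ φ, stageCost A (Sᵀ * S) R φ = ∑ i, S i ⬝ᵥ covF A R φ *ᵥ S i := by
    intro φ
    rw [stageCost, Matrix.mul_assoc, Matrix.trace_mul_comm, Matrix.mul_assoc]
    simp only [Matrix.trace, Matrix.diag, Matrix.mul_apply, dotProduct, Matrix.mulVec,
      Matrix.transpose_apply]
  have hmeas : ∀ i, AEMeasurable
      (fun ω => ENNReal.ofReal ((S i ⬝ᵥ (env.loop B K a s k ω).1) ^ 2)) P := fun i =>
    ((memLp_dotProduct hage.memLp (S i)).aestronglyMeasurable.aemeasurable.pow_const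
      2).ennreal_ofReal
  have hmeas' : ∀ i, Measurable fun ω =>
      ENNReal.ofReal (S i ⬝ᵥ covF A R (env.indicators s a k ω).1.2 *ᵥ S i) := fun i =>
    (Measurable.of_discrete (f := fun t : stateSpace =>
      ENNReal.ofReal (S i ⬝ᵥ covF A R t.1.2 *ᵥ S i))).comp
      ((ha.measurable_indicators k).mono (env.sourcesInfo_le s _) le_rfl)
  simp only [hquad, htrace]
  simp only [ENNReal.ofReal_sum_of_nonneg fun i _ => sq_nonneg _,
    ENNReal.ofReal_sum_of_nonneg fun i _ => covF_quadForm_nonneg A hR.posSemidef _ (S i)]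
  rw [lintegral_finsetSum' _ fun i _ => hmeas i, lintegral_finsetSum' _ fun i _ =>
    (hmeas' i).aemeasurable]
  refine Finset.sum_congr rfl fun i _ => ?_
  simpa using hage.lintegral_sq (S i) Set.univ MeasurableSet.univ

end Environment

/-! ### Averages of the cost along trajectories -/

section Averages

/-- Averaging the bounds `k j ≤ ∑_{i<k} u i + c (1 + u k)` over the window `[N - d, N)`. -/
lemma sum_window_le {u : ℕ → ℝ} (hu : ∀ k, 0 ≤ u k) {j c : ℝ} (hj : 0 ≤ j) (hc : 0 ≤ c) {N d : ℕ}
    (hd : d ≤ N) (h : ∀ k < N, k * j ≤ ∑ i ∈ Finset.range k, u i + c * (1 + u k)) :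
    (d : ℝ) * ((N - d) * j) ≤
      d * (∑ i ∈ Finset.range N, u i + c) + c * ∑ i ∈ Finset.range N, u i := by
  have hle : ∀ k ∈ Finset.Ico (N - d) N,
      ((N : ℝ) - d) * j ≤ (∑ i ∈ Finset.range N, u i + c) + c * u k := by
    intro k hk
    obtain ⟨h1, h2⟩ := Finset.mem_Ico.1 hk
    have h3 : ((N : ℝ) - d) ≤ k := by
      rw [← Nat.cast_sub hd]
      exact_mod_cast h1
    have h4 : ∑ i ∈ Finset.range k, u i ≤ ∑ i ∈ Finset.range N, u i :=
      Finset.sum_le_sum_of_subset_of_nonneg (Finset.range_mono h2.le) fun i _ _ => hu i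
    have h5 := mul_le_mul_of_nonneg_right h3 hj
    linarith [h k h2]
  have hsum := Finset.sum_le_sum hle
  rw [Finset.sum_const, Finset.sum_add_distrib, Finset.sum_const, ← Finset.mul_sum,
    Nat.card_Ico, Nat.sub_sub_self hd, nsmul_eq_mul, nsmul_eq_mul] at hsum
  refine hsum.trans ?_
  gcongr
  · exact fun i _ _ => hu i
  · intro i hi
    exact Finset.mem_range.2 (Finset.mem_Ico.1 hi).2

/-- If the sums of a sequence grow at rate `J` up to an error controlled by the current term, then
`J` is a lower bound for the averages, even along subsequences: the current term cannot be large on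
the whole of the window `[N - N / q, N)`. -/
lemma le_liminf_average {u : ℕ → ℝ≥0∞} {J C : ℝ≥0∞} (hJ : J ≠ ⊤) (hC : C ≠ ⊤)
    (h : ∀ N : ℕ, N * J ≤ ∑ k ∈ Finset.range N, u k + C * (1 + u N)) :
    J ≤ liminf (fun N : ℕ => (∑ k ∈ Finset.range N, u k) / N) atTop := by
  refine le_of_forall_lt_imp_le_of_dense fun L hL => ?_
  have hLtop : L ≠ ⊤ := hL.ne_top
  have hlj : L.toReal < J.toReal := (ENNReal.toReal_lt_toReal hLtop hJ).2 hL
  set j := J.toReal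
  set l := L.toReal
  set c := C.toReal
  have hj0 : 0 ≤ j := ENNReal.toReal_nonneg
  have hl0 : 0 ≤ l := ENNReal.toReal_nonneg
  have hc0 : 0 ≤ c := ENNReal.toReal_nonneg
  obtain ⟨q, hq0, hq⟩ : ∃ q : ℕ, 0 < q ∧ l < (1 - 1 / (q : ℝ)) * j := by
    have ht : Tendsto (fun q : ℕ => (1 - 1 / (q : ℝ)) * j) atTop (𝓝 ((1 - 0) * j)) :=
      (tendsto_one_div_atTop_nhds_zero_nat.const_sub 1).mul_const j
    rw [sub_zero, one_mul] at ht
    exact ((eventually_gt_atTop 0).and (ht.eventually_const_lt hlj)).exists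
  have hdiv : Tendsto (fun N : ℕ => ((N / q : ℕ) : ℝ)) atTop atTop :=
    tendsto_natCast_atTop_atTop.comp (Nat.tendsto_div_const_atTop hq0.ne')
  have hlim : Tendsto (fun N : ℕ => l + c / (N : ℝ) + c * l / ((N / q : ℕ) : ℝ)) atTop
      (𝓝 (l + 0 + 0)) :=
    ((tendsto_const_div_atTop_nhds_zero_nat c).const_add l).add (hdiv.const_div_atTop (c * l))
  rw [add_zero, add_zero] at hlim
  refine le_liminf_of_le (by isBoundedDefault) ?_
  filter_upwards [hlim.eventually_lt_const hq, eventually_ge_atTop q] with N hN hqN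
  have hN0 : 0 < N := hq0.trans_le hqN
  by_contra! hlt
  have hS : ∑ k ∈ Finset.range N, u k < L * N := by
    rwa [ENNReal.div_lt_iff (Or.inl (by exact_mod_cast hN0.ne')) (Or.inl (by finiteness))] at hlt
  have hStop : ∑ k ∈ Finset.range N, u k ≠ ⊤ := hS.ne_top
  have hfin : ∀ k < N, u k ≠ ⊤ := fun k hk =>
    (ENNReal.sum_ne_top.1 hStop) k (Finset.mem_range.2 hk)
  have htoReal : ∀ k ≤ N, (∑ i ∈ Finset.range k, u i).toReal
      = ∑ i ∈ Finset.range k, (u i).toReal := fun k hk =>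
    ENNReal.toReal_sum fun i hi => hfin i ((Finset.mem_range.1 hi).trans_le hk)
  have hreal : ∀ k < N, k * j ≤ ∑ i ∈ Finset.range k, (u i).toReal + c * (1 + (u k).toReal) := by
    intro k hk
    have hk' := hfin k hk
    have hs : ∑ i ∈ Finset.range k, u i ≠ ⊤ :=
      ENNReal.sum_ne_top.2 fun i hi => hfin i ((Finset.mem_range.1 hi).trans hk)
    have := ENNReal.toReal_mono (by finiteness) (h k)
    rwa [ENNReal.toReal_add hs (by finiteness), ENNReal.toReal_mul, ENNReal.toReal_mul,
      ENNReal.toReal_add ENNReal.one_ne_top hk', ENNReal.toReal_one, ENNReal.toReal_natCast,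
      htoReal k hk.le] at this
  have hSreal : ∑ i ∈ Finset.range N, (u i).toReal ≤ l * N := by
    rw [← htoReal N le_rfl]
    have := ENNReal.toReal_mono (by finiteness) hS.le
    rwa [ENNReal.toReal_mul, ENNReal.toReal_natCast] at this
  have hwin := sum_window_le (fun k => ENNReal.toReal_nonneg) hj0 hc0 (Nat.div_le_self N q) hreal
  set d := N / q
  have hd0 : 0 < (d : ℝ) := by exact_mod_cast Nat.div_pos hqN hq0
  have hN0' : 0 < (N : ℝ) := by exact_mod_cast hN0
  have hdq : (d : ℝ) ≤ N / q := Nat.cast_div_le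
  have hlow : (d : ℝ) * (((1 - 1 / q) * N) * j) ≤ d * ((N - d) * j) := by
    gcongr
    rw [sub_mul, one_mul, one_div, inv_mul_eq_div]
    linarith
  have hup : (d : ℝ) * (∑ i ∈ Finset.range N, (u i).toReal + c)
      + c * ∑ i ∈ Finset.range N, (u i).toReal ≤ d * (l * N + c) + c * (l * N) := by gcongr
  have hmul := mul_lt_mul_of_pos_left hN (mul_pos hd0 hN0')
  have hexp : (d : ℝ) * N * (l + c / N + c * l / d) = d * (l * N + c) + c * (l * N) := by
    field_simp
  rw [hexp] at hmul
  linarith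

end Averages

namespace Environment

variable {Ω : Type*} [mΩ : MeasurableSpace Ω] {P : Measure Ω} [IsProbabilityMeasure P] {n m : ℕ}
  {A R : Matrix (Fin n) (Fin n) ℝ} {ps pc : ℝ}
  {env : Environment P A R ps pc} {s : stateSpace} {a : ℕ → Ω → Action} {c : ℕ → ℝ}
  {V : stateSpace → ℝ} {J : ℝ}

/-- Summing the inequality `J + V ≤ c + E V` along a trajectory bounds the total cost from below. -/
lemma Causal.dynkin_le (ha : env.Causal s a) (hps : ps ∈ Set.Ioo (0 : ℝ) 1)
    (hpc : pc ∈ Set.Ioo (0 : ℝ) 1) (hV : ∀ t, 0 ≤ V t) (hJ : 0 ≤ J)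
    (h : ∀ b t, J + V t ≤ c t.1.2 + expNext ps pc b V t) (N : ℕ) :
    N * ENNReal.ofReal J + ENNReal.ofReal (V s) ≤
      ∑ k ∈ Finset.range N, ∫⁻ ω, ENNReal.ofReal (c (env.indicators s a k ω).1.2) ∂P +
        ∫⁻ ω, ENNReal.ofReal (V (env.indicators s a N ω)) ∂P := by
  induction N with
  | zero => simp [indicators]
  | succ N ih =>
    have hm := (ha.measurable_indicators N).mono (env.sourcesInfo_le s _) le_rfl
    have hstep : ENNReal.ofReal J + ∫⁻ ω, ENNReal.ofReal (V (env.indicators s a N ω)) ∂P ≤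
        ∫⁻ ω, ENNReal.ofReal (c (env.indicators s a N ω).1.2) ∂P +
          ∫⁻ ω, ENNReal.ofReal (V (env.indicators s a (N + 1) ω)) ∂P := by
      have hcm : Measurable fun ω => ENNReal.ofReal (c (env.indicators s a N ω).1.2) :=
        (Measurable.of_discrete (f := fun t : stateSpace => ENNReal.ofReal (c t.1.2))).comp hm
      rw [ha.lintegral_indicators_succ hps hpc hV, ← lintegral_add_left hcm]
      calc ENNReal.ofReal J + ∫⁻ ω, ENNReal.ofReal (V (env.indicators s a N ω)) ∂P
          = ∫⁻ ω, (ENNReal.ofReal J + ENNReal.ofReal (V (env.indicators s a N ω))) ∂P := by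
            rw [lintegral_add_left measurable_const]
            simp
        _ ≤ _ := lintegral_mono fun ω => by
            rw [← ENNReal.ofReal_add hJ (hV _)]
            exact (ENNReal.ofReal_le_ofReal (h (a N ω) _)).trans ENNReal.ofReal_add_le
    calc ((N + 1 : ℕ) : ℝ≥0∞) * ENNReal.ofReal J + ENNReal.ofReal (V s)
        = ENNReal.ofReal J + (N * ENNReal.ofReal J + ENNReal.ofReal (V s)) := by
          push_cast; ring
      _ ≤ ENNReal.ofReal J + (∑ k ∈ Finset.range N,
          ∫⁻ ω, ENNReal.ofReal (c (env.indicators s a k ω).1.2) ∂P +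
          ∫⁻ ω, ENNReal.ofReal (V (env.indicators s a N ω)) ∂P) := by gcongr
      _ = ∑ k ∈ Finset.range N, ∫⁻ ω, ENNReal.ofReal (c (env.indicators s a k ω).1.2) ∂P +
          (ENNReal.ofReal J + ∫⁻ ω, ENNReal.ofReal (V (env.indicators s a N ω)) ∂P) := by ring
      _ ≤ _ := by
          rw [Finset.sum_range_succ, add_assoc]
          gcongr

/-- Summing the inequality `c + E V ≤ J + V`, required only for the actions taken, along a
trajectory bounds the total cost from above. -/
lemma Causal.le_dynkin (ha : env.Causal s a) (hps : ps ∈ Set.Ioo (0 : ℝ) 1)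
    (hpc : pc ∈ Set.Ioo (0 : ℝ) 1) (hc : ∀ φ, 0 ≤ c φ) (hV : ∀ t, 0 ≤ V t)
    (h : ∀ k ω, c (env.indicators s a k ω).1.2 +
      expNext ps pc (a k ω) V (env.indicators s a k ω) ≤ J + V (env.indicators s a k ω)) (N : ℕ) :
    ∑ k ∈ Finset.range N, ∫⁻ ω, ENNReal.ofReal (c (env.indicators s a k ω).1.2) ∂P +
        ∫⁻ ω, ENNReal.ofReal (V (env.indicators s a N ω)) ∂P ≤
      N * ENNReal.ofReal J + ENNReal.ofReal (V s) := by
  induction N with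
  | zero => simp [indicators]
  | succ N ih =>
    have hm := (ha.measurable_indicators N).mono (env.sourcesInfo_le s _) le_rfl
    have hstep : ∫⁻ ω, ENNReal.ofReal (c (env.indicators s a N ω).1.2) ∂P +
          ∫⁻ ω, ENNReal.ofReal (V (env.indicators s a (N + 1) ω)) ∂P ≤
        ENNReal.ofReal J + ∫⁻ ω, ENNReal.ofReal (V (env.indicators s a N ω)) ∂P := by
      have hcm : Measurable fun ω => ENNReal.ofReal (c (env.indicators s a N ω).1.2) :=
        (Measurable.of_discrete (f := fun t : stateSpace => ENNReal.ofReal (c t.1.2))).comp hm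
      rw [ha.lintegral_indicators_succ hps hpc hV, ← lintegral_add_left hcm]
      calc _ ≤ ∫⁻ ω, (ENNReal.ofReal J + ENNReal.ofReal (V (env.indicators s a N ω))) ∂P := by
            refine lintegral_mono fun ω => ?_
            have h0 : 0 ≤ expNext ps pc (a N ω) V (env.indicators s a N ω) := by
              simpa [expNext_const] using expNext_mono hps hpc (a N ω) hV (env.indicators s a N ω)
            rw [← ENNReal.ofReal_add (hc _) h0]
            exact (ENNReal.ofReal_le_ofReal (h N ω)).trans ENNReal.ofReal_add_le
        _ = _ := by
            rw [lintegral_add_left measurable_const]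
            simp
    calc _ = ∑ k ∈ Finset.range N, ∫⁻ ω, ENNReal.ofReal (c (env.indicators s a k ω).1.2) ∂P +
          (∫⁻ ω, ENNReal.ofReal (c (env.indicators s a N ω).1.2) ∂P +
          ∫⁻ ω, ENNReal.ofReal (V (env.indicators s a (N + 1) ω)) ∂P) := by
          rw [Finset.sum_range_succ, add_assoc]
      _ ≤ ∑ k ∈ Finset.range N, ∫⁻ ω, ENNReal.ofReal (c (env.indicators s a k ω).1.2) ∂P +
          (ENNReal.ofReal J + ∫⁻ ω, ENNReal.ofReal (V (env.indicators s a N ω)) ∂P) := by gcongr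
      _ = ENNReal.ofReal J + (∑ k ∈ Finset.range N,
          ∫⁻ ω, ENNReal.ofReal (c (env.indicators s a k ω).1.2) ∂P +
          ∫⁻ ω, ENNReal.ofReal (V (env.indicators s a N ω)) ∂P) := by ring
      _ ≤ ENNReal.ofReal J + (N * ENNReal.ofReal J + ENNReal.ofReal (V s)) := by gcongr
      _ = _ := by push_cast; ring

/-- If each slot advances the level `i` with probability at least `p`, whatever the action, then
level `i` is reached with probability at least `p ^ i` from slot `i` on. -/
lemma Causal.pow_le_lintegral_level (ha : env.Causal s a) (hps : ps ∈ Set.Ioo (0 : ℝ) 1)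
    (hpc : pc ∈ Set.Ioo (0 : ℝ) 1) {p : ℝ} (hp : 0 ≤ p) {U : ℕ → stateSpace → ℝ}
    (hU : ∀ i t, 0 ≤ U i t) (hU0 : ∀ t, 1 ≤ U 0 t)
    (hstep : ∀ b i t, p * U i t ≤ expNext ps pc b (U (i + 1)) t) {k i : ℕ} (hik : i ≤ k) :
    ENNReal.ofReal (p ^ i) ≤ ∫⁻ ω, ENNReal.ofReal (U i (env.indicators s a k ω)) ∂P := by
  induction k generalizing i with
  | zero =>
    obtain rfl : i = 0 := by omega
    simpa [indicators] using hU0 s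
  | succ k ih =>
    cases i with
    | zero =>
      calc ENNReal.ofReal (p ^ 0) = ∫⁻ _, 1 ∂P := by simp
        _ ≤ _ := lintegral_mono fun ω => by simpa using hU0 _
    | succ i =>
      rw [ha.lintegral_indicators_succ hps hpc (hU _), pow_succ', ENNReal.ofReal_mul hp]
      calc _ ≤ ENNReal.ofReal p * ∫⁻ ω, ENNReal.ofReal (U i (env.indicators s a k ω)) ∂P := by
            gcongr
            exact ih (by omega)
        _ = ∫⁻ ω, ENNReal.ofReal (p * U i (env.indicators s a k ω)) ∂P := by
            simp only [ENNReal.ofReal_mul hp]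
            rw [lintegral_const_mul]
            exact (Measurable.of_discrete (f := fun t => ENNReal.ofReal (U i t))).comp
              ((ha.measurable_indicators k).mono (env.sourcesInfo_le s _) le_rfl)
        _ ≤ _ := lintegral_mono fun ω => ENNReal.ofReal_le_ofReal (hstep _ _ _)

end Environment

/-! ### Necessity and optimality -/

namespace Environment

variable {Ω : Type*} [mΩ : MeasurableSpace Ω] {P : Measure Ω} [IsProbabilityMeasure P] {n m : ℕ}
  {A Q R : Matrix (Fin n) (Fin n) ℝ} {ps pc : ℝ}
  {env : Environment P A R ps pc} {s : stateSpace} {a : ℕ → Ω → Action}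
  {B : Matrix (Fin n) (Fin m) ℝ} {K : Matrix (Fin m) (Fin n) ℝ}

lemma Causal.avgCost_eq (ha : env.Causal s a) (hK : A + B * K = 0) (hQ : Q.PosDef)
    (hR : R.PosDef) (N : ℕ) :
    env.avgCost B K Q a s N = (∑ k ∈ Finset.range N,
      ∫⁻ ω, ENNReal.ofReal (stageCost A Q R (env.indicators s a k ω).1.2) ∂P) / N := by
  simp only [avgCost, ha.lintegral_cost hK hQ hR]

/-- If the uplink or the downlink fails too often, then the expected stage cost grows without bound
under every scheduling sequence. -/
lemma Causal.limsup_avgCost_eq_top (ha : env.Causal s a) (hK : A + B * K = 0) (hQ : Q.PosDef)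
    (hR : R.PosDef) (hA : 1 < specRadius A) (hps : ps ∈ Set.Ioo (0 : ℝ) 1)
    (hpc : pc ∈ Set.Ioo (0 : ℝ) 1) (h : 1 / specRadius A ^ 2 ≤ max ps pc) :
    limsup (env.avgCost B K Q a s) atTop = ⊤ := by
  have hρ : 0 < specRadius A ^ 2 := by positivity
  obtain ⟨κ, hκ, hg⟩ := exists_le_costIncr (A := A) (zero_lt_one.trans hA) hQ hR
  have hg0 := costIncr_nonneg (A := A) hQ hR
  obtain ⟨h1, h2⟩ := hps
  obtain ⟨h3, h4⟩ := hpc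
  have hps' : 0 ≤ 1 - ps := by linarith
  have hpc' : 0 ≤ 1 - pc := by linarith
  -- The critical channel determines which of the two indicators carries the growth.
  obtain ⟨p, U, hp0, hp, hU, hU0, hUφ, hstep⟩ : ∃ (p : ℝ) (U : ℕ → stateSpace → ℝ), 0 ≤ p ∧
      1 / specRadius A ^ 2 ≤ p ∧ (∀ i t, 0 ≤ U i t) ∧ (∀ t, 1 ≤ U 0 t) ∧
      (∀ i t, U i t ≤ if i < t.1.2 then 1 else 0) ∧
      ∀ b i t, p * U i t ≤ expNext ps pc b (U (i + 1)) t := by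
    rcases le_max_iff.1 h with h | h
    · refine ⟨ps, fun i t => if i < t.1.1 then 1 else 0, h1.le, h, fun i t => ?_, fun t => ?_,
        fun i t => ?_, fun b i t => ?_⟩
      · dsimp only; split_ifs <;> norm_num
      · have := t.2.1
        exact (if_pos (by omega)).ge
      · have := t.2.2.2.1
        dsimp only
        split_ifs <;> first | omega | norm_num
      · cases b
        · by_cases hi : i < t.1.1 <;> simp [expNext, step, hi]
        · by_cases hi : i < t.1.1 <;> simp [expNext, step, hi, h2.le]
    · refine ⟨pc, fun i t => if i < t.1.2 then 1 else 0, h3.le, h, fun i t => ?_, fun t => ?_,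
        fun i t => le_rfl, fun b i t => ?_⟩
      · dsimp only; split_ifs <;> norm_num
      · have := t.2.2.1
        exact (if_pos (by omega)).ge
      · cases b
        · by_cases hi : i < t.1.2 <;> simp [expNext, step, hi, h4.le]
        · by_cases hi : i < t.1.2 <;> simp [expNext, step, hi] <;>
            split_ifs <;> linarith
  have hcost : ∀ k : ℕ, ENNReal.ofReal (κ * (k + 1)) ≤
      ∫⁻ ω, ENNReal.ofReal (stageCost A Q R (env.indicators s a k ω).1.2) ∂P := by
    intro k
    have hUm : ∀ i, Measurable fun ω =>
        ENNReal.ofReal (costIncr A Q R i * U i (env.indicators s a k ω)) := fun i =>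
      (Measurable.of_discrete (f := fun t => ENNReal.ofReal (costIncr A Q R i * U i t))).comp
        ((ha.measurable_indicators k).mono (env.sourcesInfo_le s _) le_rfl)
    calc ENNReal.ofReal (κ * (k + 1))
        = ∑ i ∈ Finset.range (k + 1), ENNReal.ofReal κ := by
          rw [Finset.sum_const, Finset.card_range, nsmul_eq_mul, mul_comm,
            ENNReal.ofReal_mul (by positivity)]
          congr 1
          rw [← Nat.cast_succ, ENNReal.ofReal_natCast]
      _ ≤ ∑ i ∈ Finset.range (k + 1),
          ∫⁻ ω, ENNReal.ofReal (costIncr A Q R i * U i (env.indicators s a k ω)) ∂P := by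
          refine Finset.sum_le_sum fun i hi => ?_
          have hle := ha.pow_le_lintegral_level ⟨h1, h2⟩ ⟨h3, h4⟩ hp0 hU hU0 hstep
            (Nat.lt_succ_iff.1 (Finset.mem_range.1 hi))
          have hκi : κ ≤ costIncr A Q R i * p ^ i := by
            have hone : 1 ≤ (specRadius A ^ 2 * p) ^ i :=
              one_le_pow₀ (by rwa [div_le_iff₀' hρ] at hp)
            calc κ ≤ κ * (specRadius A ^ 2 * p) ^ i := le_mul_of_one_le_right hκ.le hone
              _ = κ * (specRadius A ^ 2) ^ i * p ^ i := by rw [mul_pow, mul_assoc]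
              _ ≤ _ := by gcongr; exact hg i
          simp only [ENNReal.ofReal_mul (hg0 i)]
          rw [lintegral_const_mul' _ _ ENNReal.ofReal_ne_top]
          refine (ENNReal.ofReal_le_ofReal hκi).trans ?_
          rw [ENNReal.ofReal_mul (hg0 i)]
          gcongr
      _ = ∫⁻ ω, ∑ i ∈ Finset.range (k + 1),
          ENNReal.ofReal (costIncr A Q R i * U i (env.indicators s a k ω)) ∂P :=
          (lintegral_finsetSum _ fun i _ => hUm i).symm
      _ ≤ _ := by
          refine lintegral_mono fun ω => ?_
          dsimp only
          rw [← ENNReal.ofReal_sum_of_nonneg fun i _ => mul_nonneg (hg0 i) (hU _ _)]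
          refine ENNReal.ofReal_le_ofReal ?_
          rw [stageCost_eq_sum]
          set φ := (env.indicators s a k ω).1.2
          calc ∑ i ∈ Finset.range (k + 1), costIncr A Q R i * U i (env.indicators s a k ω)
              ≤ ∑ i ∈ Finset.range (k + 1), if i < φ then costIncr A Q R i else 0 :=
                Finset.sum_le_sum fun i _ => (mul_le_mul_of_nonneg_left (hUφ i _)
                  (hg0 i)).trans_eq (by simp [φ])
            _ = ∑ i ∈ (Finset.range (k + 1)).filter (· < φ), costIncr A Q R i :=
                (Finset.sum_filter _ _).symm
            _ ≤ ∑ i ∈ Finset.range φ, costIncr A Q R i :=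
                Finset.sum_le_sum_of_subset_of_nonneg
                  (fun i hi => Finset.mem_range.2 (Finset.mem_filter.1 hi).2) fun i _ _ => hg0 i
  have havg : ∀ N : ℕ, 0 < N → ENNReal.ofReal (κ * N / 2) ≤ env.avgCost B K Q a s N := by
    intro N hN
    rw [ha.avgCost_eq hK hQ hR, ENNReal.le_div_iff_mul_le (Or.inl (by exact_mod_cast hN.ne'))
      (Or.inl (by finiteness))]
    refine le_trans ?_ (Finset.sum_le_sum fun k _ => hcost k)
    rw [← ENNReal.ofReal_sum_of_nonneg fun k _ => by positivity, ← ENNReal.ofReal_natCast N,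
      ← ENNReal.ofReal_mul (by positivity)]
    refine ENNReal.ofReal_le_ofReal ?_
    rw [← Finset.mul_sum, Finset.sum_add_distrib, Finset.sum_const, Finset.card_range,
      nsmul_eq_mul, mul_one]
    have hgauss : (∑ i ∈ Finset.range N, (i : ℝ)) * 2 = N * (N - 1) := by
      have := Finset.sum_range_id_mul_two N
      have h' : ((∑ i ∈ Finset.range N, i : ℕ) : ℝ) * 2 = N * (N - 1 : ℕ) := by exact_mod_cast this
      rwa [Nat.cast_sub hN, Nat.cast_one, Nat.cast_sum] at h'
    nlinarith [(Nat.cast_nonneg N : (0 : ℝ) ≤ N)]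
  by_contra hne
  obtain ⟨b, hb, hbtop⟩ := exists_between (lt_top_iff_ne_top.2 hne)
  have hev := eventually_lt_of_limsup_lt hb
  have hlim : Tendsto (fun N : ℕ => κ * N / 2) atTop atTop :=
    (tendsto_natCast_atTop_atTop.const_mul_atTop hκ).atTop_div_const two_pos
  obtain ⟨N, hN1, hN2, hN3⟩ := (hev.and ((eventually_gt_atTop 0).and
    (hlim.eventually_gt_atTop b.toReal))).exists
  have h5 := (havg N hN2).trans_lt hN1
  rw [ENNReal.ofReal_lt_iff_lt_toReal (by positivity) hbtop.ne] at h5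
  linarith

/-- A solution of the average-cost optimality equation with the bounds of
`exists_averageCost_solution` yields an optimal policy of average cost `J`. -/
lemma exists_optimal_of_solution (env : Environment P A R ps pc) (hK : A + B * K = 0)
    (hQ : Q.PosDef) (hR : R.PosDef) (hps : ps ∈ Set.Ioo (0 : ℝ) 1) (hpc : pc ∈ Set.Ioo (0 : ℝ) 1)
    {J D : ℝ} {h : stateSpace → ℝ} (hJ : 0 ≤ J) (hD : 0 ≤ D) (hlow : ∀ s, -D ≤ h s)
    (hup : ∀ s, h s ≤ D * (1 + stageCost A Q R s.1.2))
    (hsol : ∀ s, J + h s = bellman ps pc (stageCost A Q R) 1 h s) :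
    ∃ π : StationaryPolicy, ∀ s,
      Tendsto (env.avgCost B K Q (env.policyActions π s) s) atTop (𝓝 (ENNReal.ofReal J)) ∧
      ∀ a, env.Admissible a →
        ENNReal.ofReal J ≤ liminf (env.avgCost B K Q a s) atTop := by
  have hc := stageCost_nonneg (A := A) hQ hR
  set V : stateSpace → ℝ := fun t => h t + D with hVdef
  have hV : ∀ t, 0 ≤ V t := fun t => neg_le_iff_add_nonneg.1 (hlow t)
  have hexp : ∀ b t, expNext ps pc b V t = expNext ps pc b h t + D := fun b t =>
    expNext_add_const _ _ _ _ _ _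
  have hle : ∀ b t, J + V t ≤ stageCost A Q R t.1.2 + expNext ps pc b V t := by
    intro b t
    have := bellman_le (ps := ps) (pc := pc) (c := stageCost A Q R) zero_le_one b h t
    rw [hexp]
    simp only [hVdef]
    linarith [hsol t]
  have hmin : ∀ t, ∃ b, stageCost A Q R t.1.2 + expNext ps pc b V t = J + V t := by
    intro t
    have ht := hsol t
    unfold bellman at ht
    simp only [hexp]
    rcases min_choice (expNext ps pc .sensor h t) (expNext ps pc .controller h t) with e | e
    · exact ⟨.sensor, by rw [e] at ht; simp only [hVdef]; linarith⟩
    · exact ⟨.controller, by rw [e] at ht; simp only [hVdef]; linarith⟩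
  choose π hπ using hmin
  have hlower : ∀ s a, env.Causal s a →
      ENNReal.ofReal J ≤ liminf (env.avgCost B K Q a s) atTop := by
    intro s a ha
    have heq : env.avgCost B K Q a s = fun N : ℕ => (∑ k ∈ Finset.range N,
        ∫⁻ ω, ENNReal.ofReal (stageCost A Q R (env.indicators s a k ω).1.2) ∂P) / N :=
      funext fun N => ha.avgCost_eq hK hQ hR N
    rw [heq]
    refine le_liminf_average (C := ENNReal.ofReal (2 * D)) ENNReal.ofReal_ne_top
      ENNReal.ofReal_ne_top fun N => ?_
    refine le_self_add.trans ((ha.dynkin_le hps hpc hV hJ hle N).trans ?_)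
    gcongr
    calc ∫⁻ ω, ENNReal.ofReal (V (env.indicators s a N ω)) ∂P
        ≤ ∫⁻ ω, ENNReal.ofReal (2 * D) *
          (1 + ENNReal.ofReal (stageCost A Q R (env.indicators s a N ω).1.2)) ∂P := by
          refine lintegral_mono fun ω => ?_
          have h0 := hc (env.indicators s a N ω).1.2
          have h1 := hup (env.indicators s a N ω)
          rw [← ENNReal.ofReal_one, ← ENNReal.ofReal_add zero_le_one h0,
            ← ENNReal.ofReal_mul (by positivity)]
          refine ENNReal.ofReal_le_ofReal ?_
          simp only [hVdef]
          nlinarith [mul_nonneg hD h0]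
      _ = _ := by
          rw [lintegral_const_mul' _ _ ENNReal.ofReal_ne_top, lintegral_add_left measurable_const]
          simp
  refine ⟨π, fun s => ⟨?_, fun a ha => hlower s a ha.causal⟩⟩
  have ha := env.causal_policyActions s π
  refine tendsto_of_le_liminf_of_limsup_le (hlower s _ ha) ?_
  have hlim : Tendsto (fun N : ℕ => ENNReal.ofReal J + ENNReal.ofReal (V s) * (N : ℝ≥0∞)⁻¹) atTop
      (𝓝 (ENNReal.ofReal J + ENNReal.ofReal (V s) * 0)) :=
    (ENNReal.Tendsto.const_mul ENNReal.tendsto_inv_nat_nhds_zero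
      (Or.inr ENNReal.ofReal_ne_top)).const_add _
  rw [mul_zero, add_zero] at hlim
  rw [← hlim.limsup_eq]
  refine limsup_le_limsup ?_
  filter_upwards [eventually_gt_atTop 0] with N hN
  have hN0 : (N : ℝ≥0∞) ≠ 0 := by exact_mod_cast hN.ne'
  rw [ha.avgCost_eq hK hQ hR, ENNReal.div_le_iff hN0 (by finiteness), add_mul, mul_assoc,
    ENNReal.inv_mul_cancel hN0 (by finiteness), mul_one, mul_comm (ENNReal.ofReal J)]
  refine le_self_add.trans (ha.le_dynkin hps hpc hc hV (fun k ω => ?_) N)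
  rw [indicators_policyActions]
  exact (hπ _).le

end Environment

end HalfDuplex

theorem theorem1 {Ω : Type*} [MeasurableSpace Ω] (P : Measure Ω) [IsProbabilityMeasure P]
    {n m : ℕ} (A : Matrix (Fin n) (Fin n) ℝ) (B : Matrix (Fin n) (Fin m) ℝ)
    (K : Matrix (Fin m) (Fin n) ℝ) (Q R : Matrix (Fin n) (Fin n) ℝ) (ps pc : ℝ)
    (hA : 1 < HalfDuplex.specRadius A) (hK : A + B * K = 0)
    (hQ : Q.PosDef) (hR : R.PosDef)
    (hps : ps ∈ Set.Ioo (0 : ℝ) 1) (hpc : pc ∈ Set.Ioo (0 : ℝ) 1)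
    (env : HalfDuplex.Environment P A R ps pc) :
    (∃ π : HalfDuplex.StationaryPolicy, env.IsOptimal B K Q π ∧
        ∀ s, env.Stabilizes B K Q (env.policyActions π s) s) ↔
      max ps pc < 1 / HalfDuplex.specRadius A ^ 2 := by
  have hρ : 0 < HalfDuplex.specRadius A ^ 2 := by positivity
  constructor
  · rintro ⟨π, -, hstab⟩
    by_contra! hge
    exact (hstab HalfDuplex.refState).ne
      ((env.causal_policyActions HalfDuplex.refState π).limsup_avgCost_eq_top hK hQ hR hA hps hpc
        hge)
  · intro hlt
    have hmax : 0 < max ps pc := hps.1.trans_le (le_max_left _ _)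
    obtain ⟨r, hr1, hr2⟩ := exists_between ((lt_one_div hmax hρ).1 hlt)
    have hr0 : 0 < r := hρ.trans hr1
    rw [lt_div_iff₀ hmax] at hr2
    obtain ⟨C, -, hgrow⟩ := HalfDuplex.exists_stageCost_add_le hA hQ hR hr1
    obtain ⟨J, D, h, hJ, hD, hlow, hup, hsol⟩ := HalfDuplex.exists_averageCost_solution
      (HalfDuplex.stageCost_nonneg hQ hR) (HalfDuplex.stageCost_mono hQ hR) hps hpc
      ((one_lt_pow₀ hA two_ne_zero).trans hr1)
      (by nlinarith [le_max_left ps pc]) (by nlinarith [le_max_right ps pc]) hgrow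
    obtain ⟨π, hπ⟩ := env.exists_optimal_of_solution hK hQ hR hps hpc hJ hD hlow hup hsol
    refine ⟨π, ⟨ENNReal.ofReal J, hπ⟩, fun s => ?_⟩
    rw [HalfDuplex.Environment.Stabilizes, (hπ s).1.limsup_eq]
    exact ENNReal.ofReal_lt_top
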